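/- Let $N\ge 1$, let $\mathbb D$ be the open unit ball of $\mathbb R^{N+1}$ with its hyperbolic distance $d$ (curvature $-1$), let $\mathbb S=\partial\mathbb D$ and $\overline{\mathbb D}=\mathbb D\cup\mathbb S$. Let $G$ be a Kleinian group, that is, a discrete group of isometries of $(\mathbb D,d)$ (not necessarily orientation preserving), acting on $\overline{\mathbb D}$ by continuous extension, and let $M_G=\mathbb D/G$. The limit set $L(H)\subset\mathbb S$ of a subgroup $H\le G$ is the set of accumulation points of the orbit $H(0)$. An end of $M_G$ is a connected open set $E\subset M_G$ with compact non-empty boundary and non-compact closure. Let $E^0_i$ ($i\in I$) be the connected components of the preimage of $E$ in $\mathbb D$ and let $G_i=\{g\in G: g(E^0_i)=E^0_i\}$. A point $\zeta\in\mathbb S$ is an endpoint of $E^0_i$ if every hyperbolic geodesic ray $\beta$ towards $\zeta$ is eventually contained in $E^0_i$, with $d(x,\partial E^0_i)\to\infty$ as $x\to\zeta$ along $\beta$; it is an end limit point of $E^0_i$ if moreover $\zeta\in L(G_i)$. The end limit set of $E$ is the set of all end limit points of all the $E^0_i$, $i\in I$; its elements are called the end limit points of $E$. A (closed) Dirichlet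 fundamental domain of $G$ is a set $F=\{z\in\mathbb D: d(z,a)\le d(z,g(a))\ \forall g\in G\}$, where $a\in\mathbb D$ is not fixed by any non-trivial element of $G$. An ending sequence tending to $\zeta\in\mathbb S$ is a sequence $(z_n)$ of points of a Dirichlet fundamental domain $F$ of $G$ that converges to $\zeta$ in the Euclidean metric and all of whose members lie within a uniformly bounded hyperbolic distance of some geodesic ray towards $\zeta$ contained in $F$. For $g\in G$ and $z\in\overline{\mathbb D}$ let $j(g,z)$ be the conformal derivative of $g$ at $z$, that is, with $w=g^{-1}(0)$, $j(g,z)=\frac{1-|w|^2}{1-2\langle z,w\rangle+|z|^2|w|^2}$, and let $P(z,s)=\sum_{g\in G}j(g,z)^s$ for $z\in\mathbb D$. Let $s>0$ be such that $P(z,s)<\infty$ (this does not depend on $z\in\mathbb D$). An $s$-conformal ending measure obtained from an ending sequence $(z_n)$ is a Borel probability measure $\mu$ on $\overline{\mathbb D}$ that is the weak limit of a subsequence of the measures $$\mu_n=\frac1{P(z_n,s)}\sum_{g\in G}j(g,z_n)^s\,\mathbf 1_{g(z_n)},$$ where $\mathbf 1_x$ is the Dirac measure at $x$. **Proposition.**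 Suppose that $M_G$ has an end $E$ whose end limit set is countable. Then, for every $s>0$ for which the Poincaré series converges, every $s$-conformal ending measure obtained from any ending sequence tending to any end limit point of $E$ is purely atomic, i.e. it gives full measure to some countable set. -/

import Mathlib

open MeasureTheory Filter Topology
open scoped ENNReal Pointwise

noncomputable section

namespace ConformalEnding

/-! ### The ball model of hyperbolic space of dimension `N + 1` -/

/-- The Euclidean space of dimension `N + 1`. -/
abbrev Euc (N : ℕ) : Type := EuclideanSpace ℝ (Fin (N + 1))

/-- The open unit ball `𝔻`. -/
abbrev Disc (N : ℕ) : Type := ↥(Metric.ball (0 : Euc N) 1)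

/-- The closed unit ball, the disjoint union of `𝔻` and of the sphere at infinity `𝕊`. -/
abbrev ClosedDisc (N : ℕ) : Type := ↥(Metric.closedBall (0 : Euc N) 1)

/-- The inclusion of `𝔻` in the closed ball. -/
def incl {N : ℕ} (z : Disc N) : ClosedDisc N :=
  ⟨z.1, Metric.ball_subset_closedBall z.2⟩

/-- The centre of the ball, as a point of `𝔻`. -/
def origin (N : ℕ) : Disc N := ⟨0, Metric.mem_ball_self one_pos⟩

/-- The hyperbolic distance (of curvature `-1`) between two points of the open unit ball. -/
def hdist {N : ℕ} (x y : Euc N) : ℝ :=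
  Real.arcosh (1 + 2 * ‖x - y‖ ^ 2 / ((1 - ‖x‖ ^ 2) * (1 - ‖y‖ ^ 2)))

/-- The homeomorphisms of the closed ball that map `𝔻` to itself and are isometric there for the
hyperbolic distance: hyperbolic isometries with their (unique) continuous extension to `𝕊`. -/
def hypIsometries (N : ℕ) : Subgroup (ClosedDisc N ≃ₜ ClosedDisc N) where
  carrier := {g | (∀ x : ClosedDisc N, ‖(g x : Euc N)‖ < 1 ↔ ‖(x : Euc N)‖ < 1) ∧
    ∀ x y : ClosedDisc N, ‖(x : Euc N)‖ < 1 → ‖(y : Euc N)‖ < 1 →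
      hdist (g x : Euc N) (g y : Euc N) = hdist (x : Euc N) (y : Euc N)}
  mul_mem' := by
    rintro a b ⟨ha, ha'⟩ ⟨hb, hb'⟩
    refine ⟨fun x => (ha (b x)).trans (hb x), fun x y hx hy => ?_⟩
    exact (ha' (b x) (b y) ((hb x).2 hx) ((hb y).2 hy)).trans (hb' x y hx hy)
  one_mem' := ⟨fun _ => Iff.rfl, fun _ _ _ _ => rfl⟩
  inv_mem' := by
    rintro a ⟨ha, ha'⟩
    have key : ∀ x : ClosedDisc N, a (a⁻¹ x) = x := fun x => a.apply_symm_apply x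
    have h1 : ∀ x : ClosedDisc N, ‖((a⁻¹ : ClosedDisc N ≃ₜ ClosedDisc N) x : Euc N)‖ < 1 ↔
        ‖(x : Euc N)‖ < 1 := fun x => by
      have := ha (a⁻¹ x)
      rw [key] at this
      exact this.symm
    refine ⟨h1, fun x y hx hy => ?_⟩
    have := ha' (a⁻¹ x) (a⁻¹ y) ((h1 x).2 hx) ((h1 y).2 hy)
    rw [key, key] at this
    exact this.symm

/-- The isometry group of hyperbolic space, acting on the closed ball. -/
abbrev Mob (N : ℕ) : Type := ↥(hypIsometries N)

instance (N : ℕ) : MulAction (Mob N) (ClosedDisc N) where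
  smul g x := (g : ClosedDisc N ≃ₜ ClosedDisc N) x
  one_smul _ := rfl
  mul_smul _ _ _ := rfl

theorem norm_smul_lt_one {N : ℕ} (g : Mob N) (z : Disc N) :
    ‖((g • incl z : ClosedDisc N) : Euc N)‖ < 1 :=
  (g.2.1 (incl z)).2 (mem_ball_zero_iff.1 z.2)

instance (N : ℕ) : MulAction (Mob N) (Disc N) where
  smul g z := ⟨(g • incl z : ClosedDisc N), mem_ball_zero_iff.2 (norm_smul_lt_one g z)⟩
  one_smul _ := rfl
  mul_smul _ _ _ := rfl

/-- A group of hyperbolic isometries is discrete if the identity is isolated in it, for the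
topology of uniform convergence on the closed ball. -/
def IsKleinian {N : ℕ} (G : Subgroup (Mob N)) : Prop :=
  ∃ ε : ℝ, 0 < ε ∧ ∀ g ∈ G, (∀ x : ClosedDisc N, dist (g • x) x < ε) → g = 1

/-- The limit set: the accumulation points in the closed ball of the orbit of the centre. -/
def limitSet {N : ℕ} (G : Subgroup (Mob N)) : Set (ClosedDisc N) :=
  derivedSet {x | ∃ g ∈ G, x = g • incl (origin N)}

/-- The conformal derivative `j(g, z) = (1 - |w|²) / (|z* - w|² |z|²)`, where `w = g⁻¹(0)` and `z*`
is the image of `z` under the reflection at `𝕊`. The denominator is expanded, so that it also has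
its right value `1` at `z = 0`. -/
def conformalDeriv {N : ℕ} (g : Mob N) (z : ClosedDisc N) : ℝ :=
  let w : Euc N := (g⁻¹ • origin N : Disc N)
  (1 - ‖w‖ ^ 2) / (1 - 2 * inner ℝ (z : Euc N) w + ‖(z : Euc N)‖ ^ 2 * ‖w‖ ^ 2)

/-- The Poincaré series `P(z, s)`. -/
def poincareSeries {N : ℕ} (G : Subgroup (Mob N)) (z : Disc N) (s : ℝ) : ℝ≥0∞ :=
  ∑' g : G, ENNReal.ofReal (conformalDeriv (g : Mob N) (incl z) ^ s)

/-! ### Geodesic rays and ends -/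

/-- `β`, restricted to `[0, ∞)`, is a hyperbolic geodesic ray, of unit speed, towards `ζ`. -/
def IsRayTowards {N : ℕ} (β : ℝ → Disc N) (ζ : ClosedDisc N) : Prop :=
  (∀ t u : ℝ, 0 ≤ t → 0 ≤ u → hdist (β t : Euc N) (β u : Euc N) = |t - u|) ∧
    Tendsto (fun t => incl (β t)) atTop (𝓝 ζ)

/-- The quotient space `M_G = 𝔻 / G`, with the quotient topology. -/
abbrev Orbifold {N : ℕ} (G : Subgroup (Mob N)) : Type :=
  Quotient (MulAction.orbitRel G (Disc N))

/-- The projection of `𝔻` to `M_G`. -/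
def proj {N : ℕ} (G : Subgroup (Mob N)) (z : Disc N) : Orbifold G :=
  Quotient.mk (MulAction.orbitRel G (Disc N)) z

/-- An end of `M_G`: a connected open subset with compact non-empty boundary and with non-compact
closure. -/
structure IsEnd {N : ℕ} (G : Subgroup (Mob N)) (E : Set (Orbifold G)) : Prop where
  isConnected : IsConnected E
  isOpen : IsOpen E
  isCompact_frontier : IsCompact (frontier E)
  nonempty_frontier : (frontier E).Nonempty
  not_isCompact_closure : ¬ IsCompact (closure E)

/-- `C` is a connected component of the lift of `E` to `𝔻`, that is, an end of `G`. -/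
def IsLift {N : ℕ} (G : Subgroup (Mob N)) (E : Set (Orbifold G)) (C : Set (Disc N)) : Prop :=
  ∃ x ∈ proj G ⁻¹' E, C = connectedComponentIn (proj G ⁻¹' E) x

/-- The end group of an end `C` of `G`: the stabiliser of the set `C` in `G`. -/
def endGroup {N : ℕ} (G : Subgroup (Mob N)) (C : Set (Disc N)) : Subgroup (Mob N) :=
  G ⊓ MulAction.stabilizer (Mob N) C

/-- `ζ ∈ 𝕊` is an endpoint of `C` if every geodesic ray towards `ζ` is eventually contained in `C`,
with hyperbolic distance to the boundary of `C` in `𝔻` tending to infinity. -/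
def IsEndpoint {N : ℕ} (C : Set (Disc N)) (ζ : ClosedDisc N) : Prop :=
  ‖(ζ : Euc N)‖ = 1 ∧ ∀ β : ℝ → Disc N, IsRayTowards β ζ →
    (∀ᶠ t in atTop, β t ∈ C) ∧
      ∀ R : ℝ, ∀ᶠ t in atTop, ∀ y ∈ frontier C, R ≤ hdist (β t : Euc N) (y : Euc N)

/-- The end limit set of the end `E` of `M_G`: the points that are, for some component `C` of the
lift of `E`, endpoints of `C` and limit points of the end group of `C`. -/
def endLimitSet {N : ℕ} (G : Subgroup (Mob N)) (E : Set (Orbifold G)) : Set (ClosedDisc N) :=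
  {ζ | ∃ C : Set (Disc N), IsLift G E C ∧ IsEndpoint C ζ ∧ ζ ∈ limitSet (endGroup G C)}

/-! ### Conformal ending measures -/

/-- The (closed) Dirichlet fundamental domain of `G` centred at `a`; here `a` is not fixed by a
non-trivial element of `G`. -/
def IsDirichletDomain {N : ℕ} (G : Subgroup (Mob N)) (F : Set (Disc N)) : Prop :=
  ∃ a : Disc N, (∀ g ∈ G, g • a = a → g = 1) ∧
    F = {z : Disc N | ∀ g ∈ G, hdist (z : Euc N) (a : Euc N) ≤
      hdist (z : Euc N) ((g • a : Disc N) : Euc N)}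

/-- `(z n)` is an ending sequence tending to `ζ`: it is contained in a Dirichlet domain `F`, tends
to `ζ`, and stays within bounded hyperbolic distance of a geodesic ray towards `ζ` in `F`. -/
def IsEndingSequence {N : ℕ} (G : Subgroup (Mob N)) (z : ℕ → Disc N) (ζ : ClosedDisc N) : Prop :=
  ∃ F : Set (Disc N), IsDirichletDomain G F ∧ (∀ n, z n ∈ F) ∧
    Tendsto (fun n => incl (z n)) atTop (𝓝 ζ) ∧
    ∃ β : ℝ → Disc N, IsRayTowards β ζ ∧ (∀ t : ℝ, 0 ≤ t → β t ∈ F) ∧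
      ∃ K : ℝ, ∀ n, ∃ t : ℝ, 0 ≤ t ∧ hdist (z n : Euc N) (β t : Euc N) ≤ K

/-- The measure `P(z, s)⁻¹ ∑ j(g, z)^s 1_{g(z)}`, the sum being over `g ∈ G`. -/
def orbitMeasure {N : ℕ} (G : Subgroup (Mob N)) (s : ℝ) (z : Disc N) : Measure (ClosedDisc N) :=
  (poincareSeries G z s)⁻¹ • Measure.sum fun g : G =>
    ENNReal.ofReal (conformalDeriv (g : Mob N) (incl z) ^ s) •
      Measure.dirac ((g : Mob N) • incl z)

/-- `μ` is an `s`-conformal ending measure obtained from the sequence `(z n)`: the exponent `s > 0`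
is such that the Poincaré series converges, and `μ` is a probability measure that is the weak limit
of a subsequence of the orbit measures at the points `z n`. -/
structure IsConformalEndingMeasure {N : ℕ} (G : Subgroup (Mob N)) (s : ℝ) (z : ℕ → Disc N)
    (μ : Measure (ClosedDisc N)) : Prop where
  exponent_pos : 0 < s
  converges : ∃ x : Disc N, poincareSeries G x s < ∞
  isProbabilityMeasure : IsProbabilityMeasure μ
  weakLimit : ∃ φ : ℕ → ℕ, StrictMono φ ∧ ∀ f : C(ClosedDisc N, ℝ),
    Tendsto (fun n => ∫ x, f x ∂(orbitMeasure G s (z (φ n)))) atTop (𝓝 (∫ x, f x ∂μ))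

/-- A Borel measure is purely atomic if it is carried by a countable set of points. -/
def IsPurelyAtomic {N : ℕ} (μ : Measure (ClosedDisc N)) : Prop :=
  ∃ A : Set (ClosedDisc N), A.Countable ∧ μ Aᶜ = 0

end ConformalEnding

end

noncomputable section

namespace ConformalEnding

variable {N : ℕ}

/-! Countability enters only at the very end: an ending measure obtained at an end limit point of
`E` gives full measure to the whole end limit set of `E`
(`IsConformalEndingMeasure.ae_mem_endLimitSet`).

The engine is a shadow estimate, `orbitMeasure_le_orbitTail`. If `g(0)` lies, up to a bounded error,
on the geodesic from `0` to `k(z)`, then `j(k, z)` is at most a constant times `(1 - |g(0)|²)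
j(g⁻¹k, z)`. Summing over `k` reproduces `P(z, s)`, which the normalisation cancels. So the mass in
the shadows of the orbit points at distance at least `T` from `0` is bounded, uniformly in `z`, by a
tail of the Poincaré series. Open sets pass to the weak limit, and sets covered by such shadows for
every `T` are null (`measure_eq_zero_of_shadow`).

The frontier of `E` is compact, so the frontier of its preimage `W` stays near the orbit `G(0)`. A
radial segment to `k(z n)` that crosses this frontier far out therefore puts `k(z n)` in a deep
shadow. This is used twice. First, the points `k(z n)` eventually lie in `W`, so almost every radial
ray moves away from the complement of `W`, and its limit is an endpoint of a component `C'` of `W`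
(`ae_hdist_radial`, `isEndpoint_of_radial`). Second, if this limit `ξ` is not a limit point of the
end group of `C'`, then no `k(z n)` near `ξ` lies in `C'` for large `n`
(`exists_open_forall_smul_notMem`, where the Dirichlet domain matters). Segments starting in `C'`
must then leave it, and such `ξ` form a null set (`ae_mem_limitSet`). -/

/-! ### Half-distance formulas and exponential bounds for the hyperbolic distance -/

/-- The quantity `1 - |x|²`, comparable to `exp (-d (0, x))`. -/
def depth (x : Euc N) : ℝ := 1 - ‖x‖ ^ 2

theorem depth_pos (x : Disc N) : 0 < depth (x : Euc N) := by
  have h := mem_ball_zero_iff.1 x.2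
  have := norm_nonneg (x : Euc N)
  unfold depth; nlinarith

theorem depth_le_one (x : Euc N) : depth x ≤ 1 := by
  have := sq_nonneg ‖x‖
  unfold depth; linarith

theorem continuous_depth : Continuous (depth : Euc N → ℝ) := by
  unfold depth; fun_prop

/-- The square of `sinh (d (x, y) / 2)`. -/
def sinhSq (x y : Euc N) : ℝ := ‖x - y‖ ^ 2 / (depth x * depth y)

theorem sinhSq_nonneg (x y : Disc N) : 0 ≤ sinhSq (x : Euc N) y :=
  div_nonneg (sq_nonneg _) (mul_pos (depth_pos x) (depth_pos y)).le

theorem sinhSq_mul (x y : Disc N) :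
    sinhSq (x : Euc N) y * (depth (x : Euc N) * depth (y : Euc N)) = ‖(x : Euc N) - y‖ ^ 2 :=
  div_mul_cancel₀ _ (mul_pos (depth_pos x) (depth_pos y)).ne'

theorem hdist_eq (x y : Euc N) : hdist x y = Real.arcosh (1 + 2 * sinhSq x y) := by
  unfold hdist sinhSq depth; rw [mul_div_assoc]

theorem hdist_comm (x y : Euc N) : hdist x y = hdist y x := by
  unfold hdist; rw [norm_sub_rev, mul_comm (1 - ‖x‖ ^ 2)]

theorem hdist_nonneg (x y : Disc N) : 0 ≤ hdist (x : Euc N) y := by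
  rw [hdist_eq]; exact Real.arcosh_nonneg (by linarith [sinhSq_nonneg x y])

theorem hdist_self (x : Euc N) : hdist x x = 0 := by simp [hdist]

theorem cosh_hdist (x y : Disc N) : Real.cosh (hdist (x : Euc N) y) = 1 + 2 * sinhSq (x : Euc N) y := by
  rw [hdist_eq]; exact Real.cosh_arcosh (by linarith [sinhSq_nonneg x y])

theorem sq_sinh_half_hdist (x y : Disc N) :
    Real.sinh (hdist (x : Euc N) y / 2) ^ 2 = sinhSq (x : Euc N) y := by
  have h1 := cosh_hdist x y
  have h2 := Real.cosh_two_mul (hdist (x : Euc N) y / 2)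
  have h3 := Real.cosh_sq (hdist (x : Euc N) y / 2)
  rw [mul_div_cancel₀ _ two_ne_zero] at h2
  linarith

theorem sq_cosh_half_hdist (x y : Disc N) :
    Real.cosh (hdist (x : Euc N) y / 2) ^ 2 = 1 + sinhSq (x : Euc N) y := by
  have h3 := Real.cosh_sq (hdist (x : Euc N) y / 2)
  rw [h3, sq_sinh_half_hdist]; ring

theorem hdist_le_hdist_iff (x y x' y' : Disc N) :
    hdist (x : Euc N) y ≤ hdist (x' : Euc N) y' ↔ sinhSq (x : Euc N) y ≤ sinhSq (x' : Euc N) y' := by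
  have h1 := sinhSq_nonneg x y
  have h2 := sinhSq_nonneg x' y'
  rw [hdist_eq, hdist_eq, Real.arcosh_le_arcosh (by linarith) (by linarith)]
  constructor <;> intro h <;> linarith

theorem hdist_lt_iff (x y : Disc N) {R : ℝ} (hR : 0 ≤ R) :
    hdist (x : Euc N) y < R ↔ sinhSq (x : Euc N) y < Real.sinh (R / 2) ^ 2 := by
  have h1 := hdist_nonneg x y
  rw [← sq_sinh_half_hdist, sq_lt_sq₀ (Real.sinh_nonneg_iff.2 (by linarith))
    (Real.sinh_nonneg_iff.2 (by linarith)), Real.sinh_lt_sinh]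
  constructor <;> intro h <;> linarith

theorem exp_hdist_le (x y : Disc N) :
    Real.exp (hdist (x : Euc N) y) ≤ 4 * (1 + sinhSq (x : Euc N) y) := by
  rw [← sq_cosh_half_hdist, Real.cosh_eq]
  have h : Real.exp (hdist (x : Euc N) y) = Real.exp (hdist (x : Euc N) y / 2) ^ 2 := by
    rw [← Real.exp_nat_mul]; congr 1; push_cast; ring
  have h1 := Real.exp_pos (hdist (x : Euc N) y / 2)
  have h2 := Real.exp_pos (-(hdist (x : Euc N) y / 2))
  rw [h]; nlinarith

theorem le_exp_hdist (x y : Disc N) :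
    1 + sinhSq (x : Euc N) y ≤ Real.exp (hdist (x : Euc N) y) := by
  rw [← sq_cosh_half_hdist, Real.cosh_eq]
  have h : Real.exp (hdist (x : Euc N) y) = Real.exp (hdist (x : Euc N) y / 2) ^ 2 := by
    rw [← Real.exp_nat_mul]; congr 1; push_cast; ring
  have h1 := Real.exp_pos (-(hdist (x : Euc N) y / 2))
  have h2 : Real.exp (-(hdist (x : Euc N) y / 2)) ≤ Real.exp (hdist (x : Euc N) y / 2) :=
    Real.exp_le_exp.2 (by linarith [hdist_nonneg x y])
  rw [h]; gcongr; linarith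

/-- This is `cosh² (d (0, x) / 2)`; it makes depth the exponential of minus the distance to the
origin, up to a factor `4`. -/
theorem one_add_sinhSq_origin (x : Disc N) :
    1 + sinhSq (origin N : Euc N) x = (depth (x : Euc N))⁻¹ := by
  have h := (depth_pos x).ne'
  have h0 : depth (origin N : Euc N) = 1 := by simp [depth, origin]
  have h2 : ‖(origin N : Euc N) - x‖ ^ 2 = 1 - depth (x : Euc N) := by simp [depth, origin]
  unfold sinhSq
  rw [h0, h2]; field_simp; ring

theorem exp_hdist_origin_le (x : Disc N) :
    Real.exp (hdist (origin N : Euc N) x) ≤ 4 * (depth (x : Euc N))⁻¹ := by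
  rw [← one_add_sinhSq_origin]; exact exp_hdist_le _ _

theorem le_exp_hdist_origin (x : Disc N) :
    (depth (x : Euc N))⁻¹ ≤ Real.exp (hdist (origin N : Euc N) x) := by
  rw [← one_add_sinhSq_origin]; exact le_exp_hdist _ _

/-! ### The triangle inequality -/

/-- Two expressions for the square of `|y| |x - y*|`, where `y*` is the image of `y` under the inversion. -/
theorem norm_sub_sq_add_depth (x y : Euc N) :
    ‖x - y‖ ^ 2 + depth x * depth y = 1 - 2 * inner ℝ x y + ‖x‖ ^ 2 * ‖y‖ ^ 2 := by
  rw [norm_sub_sq_real]; unfold depth; ring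

/-- Euclidean Ptolemy inequality for `x`, `y`, `z` and the inverse point `y*`: the square roots are
`|y| |w - y*|` for `w = z, x`, and `|y| |y - y*|` is the depth of `y`. At `y = 0`, where `y*` is at
infinity, it is the Euclidean triangle inequality. -/
theorem ptolemy_ball (x y z : Disc N) :
    ‖(x : Euc N) - z‖ * depth (y : Euc N) ≤
      ‖(x : Euc N) - y‖ * √(‖(z : Euc N) - y‖ ^ 2 + depth (z : Euc N) * depth (y : Euc N)) +
      ‖(z : Euc N) - y‖ * √(‖(x : Euc N) - y‖ ^ 2 + depth (x : Euc N) * depth (y : Euc N)) := by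
  rcases eq_or_ne (y : Euc N) 0 with h0 | h0
  · rw [h0]
    have e : ∀ w : Euc N, √(‖w - 0‖ ^ 2 + depth w * depth (0 : Euc N)) = 1 := fun w => by
      simp [depth]
    rw [e, e]
    simp only [depth, norm_zero, sub_zero]
    have := norm_sub_le (x : Euc N) z
    linarith
  · have hn : 0 < ‖(y : Euc N)‖ := norm_pos_iff.2 h0
    set y' : Euc N := (‖(y : Euc N)‖ ^ 2)⁻¹ • (y : Euc N) with hy'
    have key : ∀ w : Euc N, √(‖w - y‖ ^ 2 + depth w * depth (y : Euc N)) =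
        ‖(y : Euc N)‖ * ‖w - y'‖ := fun w => by
      rw [norm_sub_sq_add_depth, ← Real.sqrt_sq (by positivity : 0 ≤ ‖(y : Euc N)‖ * ‖w - y'‖),
        mul_pow, norm_sub_sq_real, hy', inner_smul_right, norm_smul, norm_inv, norm_pow, norm_norm]
      congr 1
      field_simp
      ring
    have hyy : ‖(y : Euc N)‖ * ‖(y : Euc N) - y'‖ = depth (y : Euc N) := by
      have := key y
      rw [← this]
      simp [Real.sqrt_mul_self (depth_pos y).le]
    have := EuclideanGeometry.mul_dist_le_mul_dist_add_mul_dist (x : Euc N) y z y'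
    simp only [dist_eq_norm] at this
    rw [key, key, ← hyy]
    rw [norm_sub_rev (y : Euc N) z] at this
    nlinarith

/-- The addition formula for `sinh` at half-distances turns this into `ptolemy_ball` once
denominators are cleared. -/
theorem hdist_triangle (x y z : Disc N) :
    hdist (x : Euc N) z ≤ hdist (x : Euc N) y + hdist (y : Euc N) z := by
  have hs : ∀ a b : Disc N, Real.sinh (hdist (a : Euc N) b / 2) =
      ‖(a : Euc N) - b‖ / √(depth (a : Euc N) * depth (b : Euc N)) := fun a b => by
    rw [← Real.sqrt_sq (Real.sinh_nonneg_iff.2 (div_nonneg (hdist_nonneg a b) two_pos.le)),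
      sq_sinh_half_hdist, sinhSq, Real.sqrt_div (sq_nonneg _), Real.sqrt_sq (norm_nonneg _)]
  have hc : ∀ a b : Disc N, Real.cosh (hdist (a : Euc N) b / 2) =
      √(‖(a : Euc N) - b‖ ^ 2 + depth (a : Euc N) * depth (b : Euc N)) /
        √(depth (a : Euc N) * depth (b : Euc N)) := fun a b => by
    have := mul_pos (depth_pos a) (depth_pos b)
    rw [← Real.sqrt_sq (Real.cosh_pos _).le, sq_cosh_half_hdist, sinhSq,
      ← Real.sqrt_div' _ this.le]
    congr 1
    rw [add_div, div_self this.ne', add_comm]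
  have hp := ptolemy_ball x y z
  rw [hdist_comm (y : Euc N) z]
  have : hdist (x : Euc N) z / 2 ≤ hdist (x : Euc N) y / 2 + hdist (z : Euc N) y / 2 := by
    rw [← Real.sinh_le_sinh, Real.sinh_add, hs x z, hs x y, hc z y, hc x y, hs z y]
    have hx := Real.sqrt_pos.2 (depth_pos x)
    have hz := Real.sqrt_pos.2 (depth_pos z)
    have hy := Real.sqrt_pos.2 (depth_pos y)
    have hyy := Real.mul_self_sqrt (depth_pos y).le
    rw [Real.sqrt_mul (depth_pos x).le, Real.sqrt_mul (depth_pos x).le,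
      Real.sqrt_mul (depth_pos z).le]
    rw [div_mul_div_comm, div_mul_div_comm]
    have e : √(depth (x : Euc N)) * √(depth (y : Euc N)) *
      (√(depth (z : Euc N)) * √(depth (y : Euc N))) = √(depth (x : Euc N)) * √(depth (z : Euc N)) *
        depth (y : Euc N) := by linear_combination (√(depth (x : Euc N)) * √(depth (z : Euc N))) * hyy
    rw [e, ← add_div, le_div_iff₀ (by have := depth_pos y; positivity), div_mul_eq_mul_div,
      div_le_iff₀ (by positivity)]
    have hxz : 0 ≤ √(depth (x : Euc N)) * √(depth (z : Euc N)) := by positivity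
    nlinarith
  linarith

/-! ### Continuity, connected sets and radial segments -/

theorem continuous_hdist : Continuous fun p : Disc N × Disc N => hdist (p.1 : Euc N) p.2 := by
  have : Continuous fun p : Disc N × Disc N => 1 + 2 * sinhSq (p.1 : Euc N) p.2 := by
    unfold sinhSq
    refine continuous_const.add (continuous_const.mul (Continuous.div ?_ ?_ ?_))
    · fun_prop
    · exact (continuous_depth.comp (by fun_prop)).mul (continuous_depth.comp (by fun_prop))
    · exact fun p => (mul_pos (depth_pos p.1) (depth_pos p.2)).ne'
  simp_rw [hdist_eq]
  exact Real.continuousOn_arcosh.comp_continuous this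
    fun p => Set.mem_Ici.2 (by linarith [sinhSq_nonneg p.1 p.2])

/-- In Euclidean terms a hyperbolic ball is a sublevel set of a convex quadratic function, hence
convex. -/
theorem isPreconnected_hball (p : Disc N) {R : ℝ} (hR : 0 ≤ R) :
    IsPreconnected {y : Disc N | hdist (p : Euc N) y < R} := by
  rw [← Topology.IsInducing.subtypeVal.isPreconnected_image]
  set c := Real.sinh (R / 2) ^ 2 * depth (p : Euc N) with hc
  have hc0 : 0 ≤ c := mul_nonneg (sq_nonneg _) (depth_pos p).le
  have : Subtype.val '' {y : Disc N | hdist (p : Euc N) y < R} =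
      Metric.ball (0 : Euc N) 1 ∩ {y : Euc N | ‖(p : Euc N) - y‖ ^ 2 + c * ‖y‖ ^ 2 < c} := by
    have key : ∀ y : Disc N, hdist (p : Euc N) y < R ↔
        ‖(p : Euc N) - y‖ ^ 2 + c * ‖(y : Euc N)‖ ^ 2 < c := fun y => by
      rw [hdist_lt_iff _ _ hR, sinhSq, div_lt_iff₀ (mul_pos (depth_pos p) (depth_pos y)), hc]
      simp only [depth]
      constructor <;> intro h <;> linarith
    ext y
    constructor
    · rintro ⟨y, hy, rfl⟩
      exact ⟨y.2, (key y).1 hy⟩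
    · rintro ⟨h1, h2⟩
      exact ⟨⟨y, h1⟩, (key ⟨y, h1⟩).2 h2, rfl⟩
  rw [this]
  refine Convex.isPreconnected ((convex_ball _ _).inter ?_)
  have h1 : ConvexOn ℝ Set.univ (fun y : Euc N => ‖(p : Euc N) - y‖ ^ 2) := by
    have := (convexOn_univ_dist (p : Euc N)).pow (fun _ _ => dist_nonneg) 2
    refine this.congr fun y _ => ?_
    simp [dist_eq_norm, norm_sub_rev]
  have h2 : ConvexOn ℝ Set.univ (fun y : Euc N => ‖y‖ ^ 2) :=
    convexOn_univ_norm.pow (fun _ _ => norm_nonneg _) 2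
  have h3 := (h1.add (h2.smul hc0)).convex_lt c
  simpa using h3

theorem isPreconnected_radial (x : Euc N) {I : Set ℝ} (hI : IsPreconnected I)
    (h : ∀ r ∈ I, ‖r • x‖ < 1) : IsPreconnected {y : Disc N | ∃ r ∈ I, (y : Euc N) = r • x} := by
  rw [← Topology.IsInducing.subtypeVal.isPreconnected_image]
  convert hI.image (fun r : ℝ => r • x) (by fun_prop) using 1
  ext y
  constructor
  · rintro ⟨y, ⟨r, hr, hy⟩, rfl⟩
    exact ⟨r, hr, hy.symm⟩
  · rintro ⟨r, hr, rfl⟩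
    exact ⟨⟨r • x, mem_ball_zero_iff.2 (h r hr)⟩, ⟨r, hr, rfl⟩, rfl⟩

theorem _root_.IsPreconnected.exists_mem_frontier {X : Type*} [TopologicalSpace X] {S V : Set X}
    (hS : IsPreconnected S) {a b : X} (ha : a ∈ S) (hb : b ∈ S) (haV : a ∈ V) (hbV : b ∉ V) :
    ∃ y ∈ S, y ∈ frontier V := by
  by_contra! h
  have h1 : a ∈ interior V := by
    by_contra h'
    exact h a ha ⟨subset_closure haV, h'⟩
  have h2 : b ∈ (closure V)ᶜ := fun h' => h b hb ⟨h', fun h'' => hbV (interior_subset h'')⟩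
  obtain ⟨y, -, hy1, hy2⟩ := hS _ _ isOpen_interior isClosed_closure.isOpen_compl
    (fun y hy => by
      by_cases hy' : y ∈ interior V
      · exact Or.inl hy'
      · exact Or.inr fun h' => h y hy ⟨h', hy'⟩) ⟨a, ha, h1⟩ ⟨b, hb, h2⟩
  exact hy2 (subset_closure (interior_subset hy1))

/-- Up to an additive constant, a point of a radial segment lies on a geodesic. -/
theorem hdist_radial_add_le {p x : Disc N} {r : ℝ} (hr0 : 0 ≤ r) (hr1 : r ≤ 1)
    (hp : (p : Euc N) = r • (x : Euc N)) :
    hdist (origin N : Euc N) p + hdist (p : Euc N) x ≤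
      hdist (origin N : Euc N) x + Real.log 32 := by
  rw [← Real.exp_le_exp, Real.exp_add, Real.exp_add, Real.exp_log (by norm_num)]
  have hp0 := depth_pos p
  have hx0 := depth_pos x
  have hx1 := mem_ball_zero_iff.1 x.2
  have hxn := norm_nonneg (x : Euc N)
  have hpn : ‖(p : Euc N)‖ = r * ‖(x : Euc N)‖ := by
    rw [hp, norm_smul, Real.norm_of_nonneg hr0]
  have hpx : ‖(p : Euc N) - x‖ = (1 - r) * ‖(x : Euc N)‖ := by
    have : (p : Euc N) - x = (-(1 - r)) • (x : Euc N) := by rw [hp]; module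
    rw [this, norm_smul, norm_neg, Real.norm_of_nonneg (by linarith)]
  have hrx : r * ‖(x : Euc N)‖ ≤ ‖(x : Euc N)‖ := mul_le_of_le_one_left hxn hr1
  have hrx0 : 0 ≤ r * ‖(x : Euc N)‖ := mul_nonneg hr0 hxn
  have h1 : depth (x : Euc N) ≤ depth (p : Euc N) := by
    unfold depth; rw [hpn]; nlinarith
  have h2 : ‖(p : Euc N) - x‖ ≤ depth (p : Euc N) := by
    rw [hpx]; unfold depth; rw [hpn]; nlinarith
  have h3 : 1 + sinhSq (p : Euc N) x ≤ 2 * (depth (p : Euc N) / depth (x : Euc N)) := by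
    unfold sinhSq
    have : ‖(p : Euc N) - x‖ ^ 2 ≤ depth (p : Euc N) ^ 2 := by gcongr
    rw [← mul_div_assoc, le_div_iff₀ hx0, add_mul, div_mul_eq_mul_div, ← le_sub_iff_add_le',
      div_le_iff₀ (by positivity)]
    nlinarith [mul_pos hp0 hx0, mul_nonneg (sub_nonneg.2 h1) (mul_pos hp0 hx0).le]
  -- The constant is `32 = 4 · 4 · 2`: one `4` from each exponential bound and the `2` from `h3`.
  calc _ ≤ (4 * (depth (p : Euc N))⁻¹) * (4 * (2 * (depth (p : Euc N) / depth (x : Euc N)))) := by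
        gcongr
        · exact exp_hdist_origin_le p
        · exact (exp_hdist_le p x).trans (by gcongr)
    _ = (depth (x : Euc N))⁻¹ * 32 := by field_simp; norm_num
    _ ≤ _ := by gcongr; exact le_exp_hdist_origin x

/-! ### Comparison of depths -/

theorem depth_le_exp_neg (x : Disc N) :
    depth (x : Euc N) ≤ 4 * Real.exp (-hdist (origin N : Euc N) x) := by
  have h := exp_hdist_origin_le x
  have hx := depth_pos x
  rw [Real.exp_neg, ← div_eq_mul_inv, le_div_iff₀ (Real.exp_pos _)]
  calc _ ≤ depth (x : Euc N) * (4 * (depth (x : Euc N))⁻¹) := by gcongr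
    _ = 4 := by field_simp

theorem exp_neg_le_depth (x : Disc N) :
    Real.exp (-hdist (origin N : Euc N) x) ≤ depth (x : Euc N) := by
  have h := le_exp_hdist_origin x
  rw [Real.exp_neg]
  exact inv_le_of_inv_le₀ (depth_pos x) h

theorem depth_le_mul_depth (x y : Disc N) :
    depth (y : Euc N) ≤ 4 * Real.exp (hdist (x : Euc N) y) * depth (x : Euc N) := by
  have h := hdist_triangle (origin N) y x
  rw [hdist_comm (y : Euc N)] at h
  calc _ ≤ 4 * Real.exp (-hdist (origin N : Euc N) y) := depth_le_exp_neg y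
    _ ≤ 4 * (Real.exp (hdist (x : Euc N) y) * Real.exp (-hdist (origin N : Euc N) x)) := by
        rw [← Real.exp_add]; gcongr; linarith
    _ ≤ 4 * (Real.exp (hdist (x : Euc N) y) * depth (x : Euc N)) := by
        gcongr; exact exp_neg_le_depth x
    _ = _ := by ring

theorem norm_sub_sq_le_mul_depth (x y : Disc N) :
    ‖(x : Euc N) - y‖ ^ 2 ≤ Real.exp (hdist (x : Euc N) y) * depth (x : Euc N) := by
  have h := le_exp_hdist x y
  have h1 := sinhSq_nonneg x y
  have hx := depth_pos x
  have hy := depth_pos y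
  have hy1 := depth_le_one (y : Euc N)
  rw [← sinhSq_mul x y]
  calc _ ≤ Real.exp (hdist (x : Euc N) y) * (depth (x : Euc N) * 1) := by gcongr; linarith
    _ = _ := by ring

/-! ### The action of the isometry group -/

theorem hdist_smul_smul (g : Mob N) (x y : Disc N) :
    hdist ((g • x : Disc N) : Euc N) (g • y : Disc N) = hdist (x : Euc N) y :=
  g.2.2 (incl x) (incl y) (mem_ball_zero_iff.1 x.2) (mem_ball_zero_iff.1 y.2)

theorem hdist_smul_left (g : Mob N) (x y : Disc N) :
    hdist ((g • x : Disc N) : Euc N) y = hdist (x : Euc N) (g⁻¹ • y : Disc N) := by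
  rw [← hdist_smul_smul g x, smul_inv_smul]

theorem incl_smul (g : Mob N) (x : Disc N) : incl (g • x) = g • incl x := rfl

theorem continuous_incl : Continuous (incl : Disc N → ClosedDisc N) :=
  continuous_subtype_val.subtype_mk _

instance : ContinuousConstSMul (Mob N) (ClosedDisc N) where
  continuous_const_smul g := (g : ClosedDisc N ≃ₜ ClosedDisc N).continuous

instance : ContinuousConstSMul (Mob N) (Disc N) where
  continuous_const_smul g := by
    have : Continuous fun x : Disc N => ((g • incl x : ClosedDisc N) : Euc N) :=
      continuous_subtype_val.comp (continuous_incl.const_smul g)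
    exact this.subtype_mk _

theorem sinhSq_smul_left (g : Mob N) (x y : Disc N) :
    sinhSq ((g • x : Disc N) : Euc N) y = sinhSq (x : Euc N) (g⁻¹ • y : Disc N) :=
  le_antisymm ((hdist_le_hdist_iff _ _ _ _).1 (hdist_smul_left g x y).le)
    ((hdist_le_hdist_iff _ _ _ _).1 (hdist_smul_left g x y).ge)

/-- The denominator of `j` is `|z - w|²` plus the product of the depths, that is `1 + sinhSq z w`
times that product; invariance of the distance then brings in the depth of `g(z)`. -/
theorem conformalDeriv_eq (g : Mob N) (z : Disc N) :
    conformalDeriv g (incl z) = depth ((g • z : Disc N) : Euc N) / depth (z : Euc N) := by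
  have hz := depth_pos z
  have hw := depth_pos (g⁻¹ • origin N : Disc N)
  have h := one_add_sinhSq_origin (g • z)
  have hc : sinhSq (origin N : Euc N) (g • z : Disc N) = sinhSq ((g • z : Disc N) : Euc N) (origin N) := by
    unfold sinhSq; rw [norm_sub_rev, mul_comm (depth _)]
  rw [hc, sinhSq_smul_left] at h
  have h2 := norm_sub_sq_add_depth (z : Euc N) (g⁻¹ • origin N : Disc N)
  have h3 := sinhSq_mul z (g⁻¹ • origin N)
  have h4 : conformalDeriv g (incl z) = depth ((g⁻¹ • origin N : Disc N) : Euc N) /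
      (1 - 2 * inner ℝ (z : Euc N) (g⁻¹ • origin N : Disc N) +
        ‖(z : Euc N)‖ ^ 2 * ‖((g⁻¹ • origin N : Disc N) : Euc N)‖ ^ 2) := rfl
  rw [h4, ← h2, ← h3, ← inv_inv (depth ((g • z : Disc N) : Euc N)), ← h]
  have := sinhSq_nonneg z (g⁻¹ • origin N)
  have h5 : sinhSq (z : Euc N) (g⁻¹ • origin N : Disc N) *
      (depth (z : Euc N) * depth ((g⁻¹ • origin N : Disc N) : Euc N)) +
      depth (z : Euc N) * depth ((g⁻¹ • origin N : Disc N) : Euc N) =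
      (1 + sinhSq (z : Euc N) (g⁻¹ • origin N : Disc N)) * depth (z : Euc N) *
      depth ((g⁻¹ • origin N : Disc N) : Euc N) := by ring
  rw [h5]
  field_simp

theorem conformalDeriv_pos (g : Mob N) (z : Disc N) : 0 < conformalDeriv g (incl z) := by
  rw [conformalDeriv_eq]; exact div_pos (depth_pos _) (depth_pos _)

/-- Depth is comparable to `exp (-d (0, ·))`, so near-additivity of distances through `g(0)` becomes
near-multiplicativity of depths, with `d (g(0), h(z)) = d (0, g⁻¹h(z))`. -/
theorem conformalDeriv_le_of_hdist_add_le {g h : Mob N} {z : Disc N} {C : ℝ}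
    (hC : hdist (origin N : Euc N) (g • origin N : Disc N) +
      hdist ((g • origin N : Disc N) : Euc N) (h • z : Disc N) ≤
        hdist (origin N : Euc N) (h • z : Disc N) + C) :
    conformalDeriv h (incl z) ≤ 4 * Real.exp C * depth ((g • origin N : Disc N) : Euc N) *
      conformalDeriv (g⁻¹ * h) (incl z) := by
  have hz := depth_pos z
  rw [conformalDeriv_eq, conformalDeriv_eq, mul_div_assoc', div_le_div_iff_of_pos_right hz]
  rw [hdist_smul_left g, ← mul_smul] at hC
  have hg := depth_pos (g • origin N : Disc N)
  calc _ ≤ 4 * Real.exp (-hdist (origin N : Euc N) (h • z : Disc N)) := depth_le_exp_neg _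
    _ ≤ 4 * (Real.exp C * Real.exp (-hdist (origin N : Euc N) (g • origin N : Disc N)) *
        Real.exp (-hdist (origin N : Euc N) ((g⁻¹ * h) • z : Disc N))) := by
        rw [← Real.exp_add, ← Real.exp_add]; gcongr; linarith
    _ ≤ 4 * (Real.exp C * depth ((g • origin N : Disc N) : Euc N) *
        depth (((g⁻¹ * h) • z : Disc N) : Euc N)) := by
        gcongr <;> exact exp_neg_le_depth _
    _ = _ := by ring

/-! ### Orbit sums -/

variable {G : Subgroup (Mob N)} {s : ℝ}

/-- The weight `(1 - |g(0)|²)^s` of an element `g`. -/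
def orbitWeight (s : ℝ) (g : Mob N) : ℝ≥0∞ :=
  ENNReal.ofReal (depth ((g • origin N : Disc N) : Euc N) ^ s)

/-- The sum of the weights of the elements that move the origin by at least `T`. -/
def orbitTail (G : Subgroup (Mob N)) (s T : ℝ) : ℝ≥0∞ :=
  ∑' g : {g : G | T ≤ hdist (origin N : Euc N) ((g : Mob N) • origin N : Disc N)},
    orbitWeight s (g : Mob N)

theorem ofReal_rpow_le_mul {a b c : ℝ} (hs : 0 ≤ s) (ha : 0 ≤ a) (hb : 0 ≤ b) (hc : 0 ≤ c)
    (h : a ≤ b * c) :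
    ENNReal.ofReal (a ^ s) ≤ ENNReal.ofReal (b ^ s) * ENNReal.ofReal (c ^ s) := by
  rw [← ENNReal.ofReal_mul (Real.rpow_nonneg hb s), ← Real.mul_rpow hb hc]
  exact ENNReal.ofReal_le_ofReal (Real.rpow_le_rpow ha h hs)

theorem tsum_orbitWeight_ne_top (hs : 0 < s) {x : Disc N} (h : poincareSeries G x s < ∞) :
    ∑' g : G, orbitWeight s (g : Mob N) ≠ ∞ := by
  have hx := depth_pos x
  have hx1 := depth_le_one (x : Euc N)
  refine ne_top_of_le_ne_top (b := ENNReal.ofReal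
    ((4 * Real.exp (hdist (x : Euc N) (origin N))) ^ s) * poincareSeries G x s)
    (ENNReal.mul_ne_top ENNReal.ofReal_ne_top h.ne) ?_
  rw [poincareSeries, ← ENNReal.tsum_mul_left]
  refine ENNReal.tsum_le_tsum fun g => ?_
  refine ofReal_rpow_le_mul hs.le (depth_pos _).le (by positivity) (conformalDeriv_pos _ _).le ?_
  have := depth_le_mul_depth ((g : Mob N) • x) ((g : Mob N) • origin N)
  rw [hdist_smul_smul] at this
  refine this.trans ?_
  rw [conformalDeriv_eq]
  gcongr
  rw [le_div_iff₀ hx]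
  exact mul_le_of_le_one_right (depth_pos _).le hx1

theorem poincareSeries_ne_top (hs : 0 < s) (h : ∑' g : G, orbitWeight s (g : Mob N) ≠ ∞)
    (z : Disc N) : poincareSeries G z s ≠ ∞ := by
  have hz := depth_pos z
  refine ne_top_of_le_ne_top (b := ENNReal.ofReal
    ((4 * Real.exp (hdist (origin N : Euc N) z) / depth (z : Euc N)) ^ s) *
      ∑' g : G, orbitWeight s (g : Mob N))
    (ENNReal.mul_ne_top ENNReal.ofReal_ne_top h) ?_
  rw [poincareSeries, ← ENNReal.tsum_mul_left]
  refine ENNReal.tsum_le_tsum fun g => ?_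
  refine ofReal_rpow_le_mul hs.le (conformalDeriv_pos _ _).le (by positivity) (depth_pos _).le ?_
  have := depth_le_mul_depth ((g : Mob N) • origin N) ((g : Mob N) • z)
  rw [hdist_smul_smul] at this
  rw [conformalDeriv_eq, div_mul_eq_mul_div]
  gcongr

theorem poincareSeries_ne_zero (z : Disc N) : poincareSeries G z s ≠ 0 := by
  refine fun h => ?_
  have := ENNReal.tsum_eq_zero.1 h 1
  have h1 := Real.rpow_pos_of_pos (conformalDeriv_pos (1 : Mob N) z) s
  simp only [OneMemClass.coe_one, ENNReal.ofReal_eq_zero] at this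
  linarith

theorem exists_orbitTail_le (h : ∑' g : G, orbitWeight s (g : Mob N) ≠ ∞) {ε : ℝ≥0∞}
    (hε : 0 < ε) : ∃ T, ∀ T' ≥ T, orbitTail G s T' ≤ ε := by
  obtain ⟨F, hF⟩ := ((ENNReal.tendsto_tsum_compl_atTop_zero h).eventually
    (ge_mem_nhds hε)).exists
  obtain ⟨T, hT⟩ := (F.image
    fun g : G => hdist (origin N : Euc N) ((g : Mob N) • origin N : Disc N)).bddAbove
  -- The `+ 1` excludes every element of `F`, including those of displacement exactly `T`.
  refine ⟨T + 1, fun T' hT' => le_trans ?_ hF⟩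
  refine ENNReal.tsum_mono_subtype (fun g : G => orbitWeight s (g : Mob N)) fun g hg hgF => ?_
  have h1 := hT (Finset.mem_coe.2 (Finset.mem_image_of_mem _ hgF))
  have h2 : T' ≤ hdist (origin N : Euc N) ((g : Mob N) • origin N : Disc N) := hg
  linarith

/-- Convergence of the series supplies the proper discontinuity needed later. -/
theorem finite_orbit_lt (h : ∑' g : G, orbitWeight s (g : Mob N) ≠ ∞) {δ : ℝ} (hs : 0 ≤ s)
    (hδ : 0 < δ) :
    {g : G | δ ≤ depth (((g : Mob N) • origin N : Disc N) : Euc N)}.Finite := by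
  refine (ENNReal.finite_const_le_of_tsum_ne_top h
    (ENNReal.ofReal_pos.2 (Real.rpow_pos_of_pos hδ s)).ne').subset fun g hg => ?_
  exact ENNReal.ofReal_le_ofReal (Real.rpow_le_rpow hδ.le hg hs)

/-! ### Orbit measures -/

theorem orbitMeasure_apply (z : Disc N) {V : Set (ClosedDisc N)} (hV : MeasurableSet V) :
    orbitMeasure G s z V = (poincareSeries G z s)⁻¹ * ∑' g : G,
      ENNReal.ofReal (conformalDeriv (g : Mob N) (incl z) ^ s) *
        V.indicator 1 ((g : Mob N) • incl z) := by
  rw [orbitMeasure, Measure.smul_apply, Measure.sum_apply _ hV, smul_eq_mul]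
  simp [Measure.dirac_apply' _ hV]

theorem isProbabilityMeasure_orbitMeasure (z : Disc N) (h : poincareSeries G z s ≠ ∞) :
    IsProbabilityMeasure (orbitMeasure G s z) := by
  constructor
  rw [orbitMeasure_apply z MeasurableSet.univ]
  simp only [Set.indicator_univ, Pi.one_apply, mul_one]
  exact ENNReal.inv_mul_cancel (poincareSeries_ne_zero z) h

/-- The shadow estimate. -/
theorem orbitMeasure_le_orbitTail (hs : 0 ≤ s) (z : Disc N) {V : Set (ClosedDisc N)}
    (hV : MeasurableSet V) {T C : ℝ}
    (h : ∀ k ∈ G, k • incl z ∈ V → ∃ g ∈ G, T ≤ hdist (origin N : Euc N) (g • origin N : Disc N) ∧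
      hdist (origin N : Euc N) (g • origin N : Disc N) +
        hdist ((g • origin N : Disc N) : Euc N) (k • z : Disc N) ≤
          hdist (origin N : Euc N) (k • z : Disc N) + C) :
    orbitMeasure G s z V ≤ ENNReal.ofReal ((4 * Real.exp C) ^ s) * orbitTail G s T := by
  rw [orbitMeasure_apply z hV]
  set A := ENNReal.ofReal ((4 * Real.exp C) ^ s) with hA
  set S := {g : G | T ≤ hdist (origin N : Euc N) ((g : Mob N) • origin N : Disc N)} with hS
  have key : ∑' k : G, ENNReal.ofReal (conformalDeriv (k : Mob N) (incl z) ^ s) *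
        V.indicator 1 ((k : Mob N) • incl z) ≤
      (A * orbitTail G s T) * poincareSeries G z s := by
    -- Each `k` with `k(z)` in `V` is charged to one shadowing `g`. After exchanging the sums, left
    -- translation by `g⁻¹` makes every inner sum the full Poincaré series.
    calc _ ≤ ∑' k : G, ∑' g : S, A * orbitWeight s ((g : G) : Mob N) *
            ENNReal.ofReal (conformalDeriv (((g : G)⁻¹ * k : G) : Mob N) (incl z) ^ s) := by
          refine ENNReal.tsum_le_tsum fun k => ?_
          by_cases hk : (k : Mob N) • incl z ∈ V
          · obtain ⟨g, hg, hgT, hgC⟩ := h k k.2 hk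
            refine le_trans ?_ (ENNReal.le_tsum (⟨⟨g, hg⟩, hgT⟩ : S))
            rw [Set.indicator_of_mem hk, Pi.one_apply, mul_one, hA, orbitWeight,
              ← ENNReal.ofReal_mul (by positivity), ← Real.mul_rpow (by positivity) (depth_pos _).le]
            exact ofReal_rpow_le_mul hs (conformalDeriv_pos _ _).le
              (mul_nonneg (by positivity) (depth_pos _).le) (conformalDeriv_pos _ _).le
              (conformalDeriv_le_of_hdist_add_le hgC)
          · simp [Set.indicator_of_notMem hk]
      _ = ∑' g : S, A * orbitWeight s ((g : G) : Mob N) * poincareSeries G z s := by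
          rw [ENNReal.tsum_comm]
          refine tsum_congr fun g => ?_
          rw [ENNReal.tsum_mul_left]
          congr 1
          exact (Equiv.mulLeft (g : G)⁻¹).tsum_eq fun k : G =>
            ENNReal.ofReal (conformalDeriv (k : Mob N) (incl z) ^ s)
      _ = _ := by
          rw [ENNReal.tsum_mul_right, ENNReal.tsum_mul_left]; rfl
  calc _ ≤ (poincareSeries G z s)⁻¹ * ((A * orbitTail G s T) * poincareSeries G z s) := by gcongr
    _ = (A * orbitTail G s T) * ((poincareSeries G z s)⁻¹ * poincareSeries G z s) := by ring
    _ ≤ (A * orbitTail G s T) * 1 := by gcongr; exact ENNReal.inv_mul_le_one _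
    _ = _ := mul_one _

/-- Portmanteau theorem for open sets, applied along the subsequence. -/
theorem IsConformalEndingMeasure.measure_le_of_isOpen {z : ℕ → Disc N} {μ : Measure (ClosedDisc N)}
    (hμ : IsConformalEndingMeasure G s z μ) {V : Set (ClosedDisc N)} (hV : IsOpen V) {ε : ℝ≥0∞}
    (h : ∀ᶠ n in atTop, orbitMeasure G s (z n) V ≤ ε) : μ V ≤ ε := by
  obtain ⟨x, hx⟩ := hμ.converges
  have hfin := tsum_orbitWeight_ne_top hμ.exponent_pos hx
  have hp : ∀ z : Disc N, IsProbabilityMeasure (orbitMeasure G s z) := fun z =>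
    isProbabilityMeasure_orbitMeasure z (poincareSeries_ne_top hμ.exponent_pos hfin z)
  have := hμ.isProbabilityMeasure
  obtain ⟨φ, hφ, hlim⟩ := hμ.weakLimit
  let ν : ℕ → ProbabilityMeasure (ClosedDisc N) := fun n => ⟨orbitMeasure G s (z (φ n)), hp _⟩
  let μ' : ProbabilityMeasure (ClosedDisc N) := ⟨μ, this⟩
  have ht : Tendsto ν atTop (𝓝 μ') :=
    ProbabilityMeasure.tendsto_iff_forall_integral_tendsto.2 fun f => hlim f.toContinuousMap
  refine (ProbabilityMeasure.le_liminf_measure_open_of_tendsto ht hV).trans ?_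
  exact liminf_le_of_frequently_le' (hφ.tendsto_atTop.eventually h).frequently

/-! ### Radial rays -/

/-- The point `r x` of the radial segment from the origin to `x`. -/
def radial (r : Set.Ico (0 : ℝ) 1) (x : ClosedDisc N) : Disc N :=
  ⟨(r : ℝ) • (x : Euc N), by
    have hx := mem_closedBall_zero_iff.1 x.2
    rw [mem_ball_zero_iff, norm_smul, Real.norm_of_nonneg r.2.1]
    exact (mul_le_of_le_one_right r.2.1 hx).trans_lt r.2.2⟩

theorem coe_radial (r : Set.Ico (0 : ℝ) 1) (x : ClosedDisc N) :
    (radial r x : Euc N) = (r : ℝ) • (x : Euc N) := rfl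

theorem continuous_radial (r : Set.Ico (0 : ℝ) 1) :
    Continuous (radial r : ClosedDisc N → Disc N) := by
  have : Continuous fun x : ClosedDisc N => (r : ℝ) • (x : Euc N) := by fun_prop
  exact this.subtype_mk _

theorem depth_radial (r : Set.Ico (0 : ℝ) 1) {ξ : ClosedDisc N} (hξ : ‖(ξ : Euc N)‖ = 1) :
    depth (radial r ξ : Euc N) = 1 - (r : ℝ) ^ 2 := by
  rw [depth, coe_radial, norm_smul, hξ, mul_one, Real.norm_of_nonneg r.2.1]

theorem hdist_origin_le_iff (x y : Disc N) :
    hdist (origin N : Euc N) x ≤ hdist (origin N : Euc N) y ↔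
      depth (y : Euc N) ≤ depth (x : Euc N) := by
  rw [hdist_le_hdist_iff, ← add_le_add_iff_left (1 : ℝ), one_add_sinhSq_origin,
    one_add_sinhSq_origin, inv_le_inv₀ (depth_pos x) (depth_pos y)]

theorem exists_lt_hdist_radial (T : ℝ) : ∃ r₀ : Set.Ico (0 : ℝ) 1, ∀ r, r₀ ≤ r →
    ∀ ξ : ClosedDisc N, ‖(ξ : Euc N)‖ = 1 → T < hdist (origin N : Euc N) (radial r ξ) := by
  have hT := Real.exp_pos (-T)
  -- Then `1 - r² ≤ 2 (1 - r) ≤ exp (-T) / 2` is smaller than `exp (-T)`.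
  refine ⟨⟨max 0 (1 - Real.exp (-T) / 4), le_max_left _ _, max_lt one_pos (by linarith)⟩,
    fun r hr ξ hξ => ?_⟩
  have h1 : 1 - Real.exp (-T) / 4 ≤ (r : ℝ) := (le_max_right _ _).trans hr
  have h2 := exp_neg_le_depth (radial r ξ)
  rw [depth_radial r hξ] at h2
  have h0 := r.2.1
  have h3 := r.2.2
  have : Real.exp (-hdist (origin N : Euc N) (radial r ξ)) < Real.exp (-T) := by nlinarith
  rw [Real.exp_lt_exp] at this
  linarith

/-- The shadow of `y` has Euclidean size comparable to the depth of `y`. -/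
theorem norm_sub_sq_le_of_hdist_add_le {x y : Disc N} {C : ℝ}
    (h : hdist (origin N : Euc N) y + hdist (y : Euc N) x ≤ hdist (origin N : Euc N) x + C) :
    ‖(y : Euc N) - x‖ ^ 2 ≤ 4 * Real.exp C * depth (y : Euc N) ^ 2 := by
  have hx := depth_pos x
  have hy := depth_pos y
  have hs := sinhSq_nonneg y x
  have h1 : (depth (y : Euc N))⁻¹ * sinhSq (y : Euc N) x ≤
      4 * (depth (x : Euc N))⁻¹ * Real.exp C :=
    calc _ ≤ Real.exp (hdist (origin N : Euc N) y) * Real.exp (hdist (y : Euc N) x) := by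
          gcongr
          · exact le_exp_hdist_origin y
          · linarith [le_exp_hdist y x]
      _ ≤ Real.exp (hdist (origin N : Euc N) x) * Real.exp C := by
          rw [← Real.exp_add, ← Real.exp_add]; gcongr
      _ ≤ _ := by gcongr; exact exp_hdist_origin_le x
  rw [← sinhSq_mul y x]
  calc _ = ((depth (y : Euc N))⁻¹ * sinhSq (y : Euc N) x) *
          (depth (y : Euc N) ^ 2 * depth (x : Euc N)) := by field_simp
    _ ≤ (4 * (depth (x : Euc N))⁻¹ * Real.exp C) *
          (depth (y : Euc N) ^ 2 * depth (x : Euc N)) := by gcongr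
    _ = _ := by field_simp

theorem IsRayTowards.sub_le_hdist {β : ℝ → Disc N} {ξ : ClosedDisc N} (hβ : IsRayTowards β ξ)
    {t : ℝ} (ht : 0 ≤ t) :
    t - hdist (origin N : Euc N) (β 0) ≤ hdist (origin N : Euc N) (β t) := by
  have h1 := hβ.1 0 t le_rfl ht
  rw [zero_sub, abs_neg, abs_of_nonneg ht] at h1
  have h2 := hdist_triangle (β 0) (origin N) (β t)
  rw [hdist_comm (β 0 : Euc N) (origin N)] at h2
  linarith

/-- A geodesic ray stays within bounded distance of the radial ray with the same endpoint. -/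
theorem IsRayTowards.exists_hdist_radial_le {β : ℝ → Disc N} {ξ : ClosedDisc N}
    (hβ : IsRayTowards β ξ) (hξ : ‖(ξ : Euc N)‖ = 1) :
    ∃ K : ℝ, ∀ t, 0 ≤ t → ∃ r : Set.Ico (0 : ℝ) 1, hdist (β t : Euc N) (radial r ξ) ≤ K := by
  set k := hdist (origin N : Euc N) (β 0) with hk
  set A := 2 * Real.exp k with hA
  refine ⟨Real.log (4 * (1 + (A + 1) ^ 2)), fun t ht => ?_⟩
  set y := β t with hy
  have hyn := mem_ball_zero_iff.1 y.2
  have hy0 := norm_nonneg (y : Euc N)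
  have hyd := depth_pos y
  have h1 : ‖(y : Euc N) - ξ‖ ^ 2 ≤ (A * depth (y : Euc N)) ^ 2 := by
    have hlim : Tendsto (fun u => ‖(y : Euc N) - β u‖ ^ 2) atTop (𝓝 (‖(y : Euc N) - ξ‖ ^ 2)) :=
      ((tendsto_const_nhds.sub ((continuous_subtype_val.tendsto ξ).comp hβ.2)).norm).pow 2
    refine le_of_tendsto hlim ((eventually_ge_atTop t).mono fun u hu => ?_)
    have h3 := hβ.1 t u ht (ht.trans hu)
    have h4 := hβ.1 0 t le_rfl ht
    rw [zero_sub, abs_neg, abs_of_nonneg ht] at h4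
    rw [abs_sub_comm, abs_of_nonneg (sub_nonneg.2 hu)] at h3
    have h5 := hdist_triangle (origin N) (β 0) (β t)
    have h6 := hβ.sub_le_hdist (ht.trans hu)
    -- The ray starts at distance `k` from the origin; comparing distances from `0` and from `β 0`
    -- costs `k` twice.
    refine (norm_sub_sq_le_of_hdist_add_le (C := 2 * k) (by linarith)).trans (le_of_eq ?_)
    rw [two_mul, Real.exp_add, hA]; ring
  have h2 : ‖(y : Euc N) - ξ‖ ≤ A * depth (y : Euc N) := abs_le_of_sq_le_sq' h1 (by positivity) |>.2
  -- The radial point of the same norm has the same depth, and its Euclidean distance to `y` is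
  -- bounded by a multiple of it.
  refine ⟨⟨‖(y : Euc N)‖, hy0, hyn⟩, ?_⟩
  set p := radial ⟨‖(y : Euc N)‖, hy0, hyn⟩ ξ with hp
  have hpd : depth (p : Euc N) = depth (y : Euc N) := depth_radial _ hξ
  have h3 : ‖(ξ : Euc N) - p‖ ≤ depth (y : Euc N) := by
    have : (ξ : Euc N) - p = (1 - ‖(y : Euc N)‖) • (ξ : Euc N) := by rw [hp, coe_radial]; module
    rw [this, norm_smul, hξ, Real.norm_of_nonneg (by linarith)]
    unfold depth; nlinarith
  have h4 : ‖(y : Euc N) - p‖ ≤ (A + 1) * depth (y : Euc N) := by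
    have := norm_sub_le_norm_sub_add_norm_sub (y : Euc N) ξ p
    linarith
  have h5 : sinhSq (y : Euc N) p ≤ (A + 1) ^ 2 := by
    rw [sinhSq, hpd, div_le_iff₀ (by positivity)]
    calc _ ≤ ((A + 1) * depth (y : Euc N)) ^ 2 := by gcongr
      _ = _ := by ring
  rw [Real.le_log_iff_exp_le (by positivity)]
  exact (exp_hdist_le _ _).trans (by gcongr)

/-! ### Components and frontiers -/

instance : LocallyConnectedSpace (Disc N) := Metric.isOpen_ball.locallyConnectedSpace

/-- A frontier point inside `W` would have an open component meeting, hence equal to, the given one.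
-/
theorem frontier_connectedComponentIn_subset {W : Set (Disc N)} (hW : IsOpen W) (x : Disc N) :
    frontier (connectedComponentIn W x) ⊆ frontier W := by
  rw [hW.connectedComponentIn.frontier_eq, hW.frontier_eq]
  rintro y ⟨h1, h2⟩
  refine ⟨closure_mono (connectedComponentIn_subset _ _) h1, fun hy => h2 ?_⟩
  obtain ⟨w, hw1, hw2⟩ := mem_closure_iff.1 h1 _ (hW.connectedComponentIn (x := y))
    (mem_connectedComponentIn hy)
  rw [connectedComponentIn_eq hw2, ← connectedComponentIn_eq hw1]
  exact mem_connectedComponentIn hy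

variable {E : Set (Orbifold G)}

theorem continuous_proj : Continuous (proj G) := continuous_quotient_mk'

instance : ContinuousConstSMul G (Disc N) where
  continuous_const_smul g := continuous_const_smul (g : Mob N)

theorem isOpenMap_proj : IsOpenMap (proj G) := isOpenMap_quotient_mk'_mul

theorem smul_mem_preimage_proj {g : Mob N} (hg : g ∈ G) {x : Disc N} (hx : x ∈ proj G ⁻¹' E) :
    g • x ∈ proj G ⁻¹' E := by
  have : proj G (g • x) = proj G x := Quotient.sound ⟨(⟨g, hg⟩ : G), rfl⟩
  rwa [Set.mem_preimage, this]

theorem smul_connectedComponentIn {g : Mob N} (hg : g ∈ G) {x x' y : Disc N}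
    (hy : y ∈ connectedComponentIn (proj G ⁻¹' E) x)
    (hy' : g • y ∈ connectedComponentIn (proj G ⁻¹' E) x') :
    g • connectedComponentIn (proj G ⁻¹' E) x = connectedComponentIn (proj G ⁻¹' E) x' := by
  rw [connectedComponentIn_eq hy, connectedComponentIn_eq hy']
  have h := (Homeomorph.smul g : Disc N ≃ₜ Disc N).image_connectedComponentIn
    (connectedComponentIn_subset _ _ hy)
  have hW : (Homeomorph.smul g : Disc N ≃ₜ Disc N) '' (proj G ⁻¹' E) = proj G ⁻¹' E := by
    ext w
    constructor
    · rintro ⟨v, hv, rfl⟩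
      exact smul_mem_preimage_proj hg hv
    · exact fun hw => ⟨g⁻¹ • w, smul_mem_preimage_proj (inv_mem hg) hw, smul_inv_smul g w⟩
  rw [hW] at h
  exact h

theorem continuous_hdist_left (p : Disc N) : Continuous fun x : Disc N => hdist (x : Euc N) p := by
  have h : Continuous fun x : Disc N => (x, p) := by fun_prop
  have h' := Continuous.comp' (continuous_hdist (N := N)) h
  exact h'

/-- The frontier of the lift of an end stays within bounded distance of an orbit. -/
theorem IsEnd.exists_hdist_le (hE : IsEnd G E) :
    ∃ ρ : ℝ, ∀ y ∈ frontier (proj G ⁻¹' E), ∃ g ∈ G,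
      hdist (y : Euc N) (g • origin N : Disc N) ≤ ρ := by
  have hopen : ∀ n : ℕ, IsOpen (proj G '' {x : Disc N | hdist (x : Euc N) (origin N) < n}) :=
    fun n => by
      have hn : IsOpen {x : Disc N | hdist (x : Euc N) (origin N) < n} :=
        isOpen_lt (continuous_hdist_left _) continuous_const
      exact isOpenMap_proj (G := G) _ hn
  -- The projected balls about the origin are an increasing open cover of the quotient, so one
  -- contains the compact frontier.
  obtain ⟨n, hn⟩ := hE.isCompact_frontier.elim_directed_cover _ hopen
    (fun y _ => by
      obtain ⟨x, rfl⟩ := Quotient.exists_rep y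
      obtain ⟨n, hn⟩ := exists_nat_gt (hdist (x : Euc N) (origin N))
      exact Set.mem_iUnion.2 ⟨n, x, hn, rfl⟩)
    (directed_of_isDirected_le fun m n hmn => Set.image_mono fun x hx => by
      have hx' : hdist (x : Euc N) (origin N) < m := hx
      exact hx'.trans_le (Nat.cast_le.2 hmn))
  refine ⟨n, fun y hy => ?_⟩
  obtain ⟨x, hx, hxy⟩ := hn (continuous_proj.frontier_preimage_subset E hy)
  obtain ⟨g, hg⟩ := Quotient.exact hxy.symm
  refine ⟨g, g.2, ?_⟩
  have hg' : (g : Mob N) • x = y := hg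
  rw [← hg', hdist_smul_smul]
  exact le_of_lt hx

/-- A radial segment from near a point on one side of `V` to a point on the other side passes
close to an orbit, if the frontier of `V` is close to that orbit. -/
theorem exists_hdist_add_le {V : Set (Disc N)} {ρ : ℝ}
    (hV : ∀ y ∈ frontier V, ∃ g ∈ G, hdist (y : Euc N) (g • origin N : Disc N) ≤ ρ)
    {x q : Disc N} {r : Set.Ico (0 : ℝ) 1} {R T : ℝ}
    (hT : T ≤ hdist (origin N : Euc N) (radial r (incl x)))
    (hq : hdist (radial r (incl x) : Euc N) q < R) (hqx : ¬ (q ∈ V ↔ x ∈ V)) :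
    ∃ g ∈ G, T - (R + ρ) ≤ hdist (origin N : Euc N) (g • origin N : Disc N) ∧
      hdist (origin N : Euc N) (g • origin N : Disc N) +
        hdist ((g • origin N : Disc N) : Euc N) x ≤
          hdist (origin N : Euc N) x + (Real.log 32 + 2 * (R + ρ)) := by
  set p := radial r (incl x) with hp
  have hR : 0 < R := (hdist_nonneg _ _).trans_lt hq
  have hx1 := mem_ball_zero_iff.1 x.2
  -- The ball around `p` joins `q` to the segment from `p` to `x`; this connected union must meet
  -- the frontier of `V`.
  have hS : IsPreconnected ({y : Disc N | hdist (p : Euc N) y < R} ∪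
      {y : Disc N | ∃ t ∈ Set.Icc (r : ℝ) 1, (y : Euc N) = t • (x : Euc N)}) := by
    refine IsPreconnected.union p ?_ ?_ (isPreconnected_hball p hR.le)
      (isPreconnected_radial _ isPreconnected_Icc fun t ht => ?_)
    · simpa [hdist_self] using hR
    · exact ⟨r, ⟨le_rfl, r.2.2.le⟩, rfl⟩
    · have h0 : 0 ≤ t := r.2.1.trans ht.1
      rw [norm_smul, Real.norm_of_nonneg h0]
      exact (mul_le_of_le_one_left (norm_nonneg _) ht.2).trans_lt hx1
  have hqS : q ∈ {y : Disc N | hdist (p : Euc N) y < R} ∪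
      {y : Disc N | ∃ t ∈ Set.Icc (r : ℝ) 1, (y : Euc N) = t • (x : Euc N)} := Or.inl hq
  have hxS : x ∈ {y : Disc N | hdist (p : Euc N) y < R} ∪
      {y : Disc N | ∃ t ∈ Set.Icc (r : ℝ) 1, (y : Euc N) = t • (x : Euc N)} :=
    Or.inr ⟨1, ⟨r.2.2.le, le_rfl⟩, (one_smul _ _).symm⟩
  obtain ⟨y, hyS, hyV⟩ : ∃ y ∈ ({y : Disc N | hdist (p : Euc N) y < R} ∪
      {y : Disc N | ∃ t ∈ Set.Icc (r : ℝ) 1, (y : Euc N) = t • (x : Euc N)}), y ∈ frontier V := by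
    by_cases h : q ∈ V
    · exact hS.exists_mem_frontier hqS hxS h (by tauto)
    · exact hS.exists_mem_frontier hxS hqS (by tauto) h
  obtain ⟨g, hg, hgy⟩ := hV y hyV
  obtain ⟨p', t, ht, hp', hpy⟩ : ∃ p' : Disc N, ∃ t ∈ Set.Icc (r : ℝ) 1,
      (p' : Euc N) = t • (x : Euc N) ∧ hdist (p' : Euc N) y ≤ R := by
    rcases hyS with h | ⟨t, ht, hy⟩
    · exact ⟨p, r, ⟨le_rfl, r.2.2.le⟩, rfl, le_of_lt h⟩
    · exact ⟨y, t, ht, hy, by rw [hdist_self]; exact hR.le⟩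
  have ht0 : 0 ≤ t := r.2.1.trans ht.1
  have h1 := hdist_radial_add_le ht0 ht.2 hp'
  have h2 := hdist_triangle p' y (g • origin N)
  have h3 := hdist_triangle (origin N) p' (g • origin N)
  have h4 := hdist_triangle (origin N) (g • origin N) p'
  have h5 := hdist_triangle (g • origin N) p' x
  rw [hdist_comm ((g • origin N : Disc N) : Euc N) p'] at h4 h5
  have h6 : hdist (origin N : Euc N) p ≤ hdist (origin N : Euc N) p' := by
    rw [hdist_origin_le_iff]
    unfold depth
    have e1 : (p : Euc N) = (r : ℝ) • (x : Euc N) := rfl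
    rw [hp', e1, norm_smul, norm_smul, Real.norm_of_nonneg ht0, Real.norm_of_nonneg r.2.1]
    have := ht.1
    have := r.2.1
    gcongr
  exact ⟨g, hg, by linarith, by linarith⟩

/-- A hyperbolic ball that meets `C` and is disjoint from its frontier lies in `C`. -/
theorem mem_of_hdist_lt {C : Set (Disc N)} {p y : Disc N} {R : ℝ} (hp : p ∈ C)
    (hC : ∀ q ∈ frontier C, R ≤ hdist (p : Euc N) q) (hy : hdist (p : Euc N) y < R) : y ∈ C := by
  by_contra h
  have hR : 0 < R := (hdist_nonneg _ _).trans_lt hy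
  obtain ⟨q, hq, hqC⟩ := (isPreconnected_hball p hR.le).exists_mem_frontier
    (a := p) (b := y) (by simpa [hdist_self] using hR) hy hp h
  exact absurd (hC q hqC) (not_le.2 hq)

/-! ### Endpoints -/

/-- The part of a radial ray beyond `r₀` lies in one component of `W` if it lies in `W`. -/
theorem radial_mem_connectedComponentIn {W : Set (Disc N)} {ξ : ClosedDisc N}
    {r₀ r : Set.Ico (0 : ℝ) 1} (h : ∀ r, r₀ ≤ r → radial r ξ ∈ W) (hr : r₀ ≤ r) :
    radial r ξ ∈ connectedComponentIn W (radial r₀ ξ) := by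
  have hpre : IsPreconnected {y : Disc N | ∃ t ∈ Set.Ico (r₀ : ℝ) 1, (y : Euc N) = t • (ξ : Euc N)} :=
    isPreconnected_radial _ isPreconnected_Ico fun t ht =>
      mem_ball_zero_iff.1 (radial ⟨t, r₀.2.1.trans ht.1, ht.2⟩ ξ).2
  refine hpre.subset_connectedComponentIn ⟨r₀, ⟨le_rfl, r₀.2.2⟩, rfl⟩ ?_ ⟨r, ⟨hr, r.2.2⟩, rfl⟩
  rintro y ⟨t, ht, hy⟩
  have : y = radial ⟨t, r₀.2.1.trans ht.1, ht.2⟩ ξ := Subtype.ext hy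
  rw [this]
  exact h _ ht.1

/-- Every ray towards `ξ` stays within a bounded distance of the radial one, and the frontier of the
component misses `W`; so the hypothesis transfers to all rays. -/
theorem isEndpoint_of_radial {W : Set (Disc N)} (hW : IsOpen W) {ξ : ClosedDisc N}
    (hξ : ‖(ξ : Euc N)‖ = 1)
    (h : ∀ R : ℝ, ∃ T : ℝ, ∀ r, T < hdist (origin N : Euc N) (radial r ξ) →
      ∀ q ∉ W, R ≤ hdist (radial r ξ : Euc N) q)
    {r₀ : Set.Ico (0 : ℝ) 1} (hr₀ : ∀ r, r₀ ≤ r → radial r ξ ∈ W) :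
    IsEndpoint (connectedComponentIn W (radial r₀ ξ)) ξ := by
  refine ⟨hξ, fun β hβ => ?_⟩
  obtain ⟨K, hK⟩ := hβ.exists_hdist_radial_le hξ
  have hfr : ∀ q ∈ frontier (connectedComponentIn W (radial r₀ ξ)), q ∉ W := fun q hq hqW => by
    have := frontier_connectedComponentIn_subset hW _ hq
    rw [hW.frontier_eq] at this
    exact this.2 hqW
  have key : ∀ R : ℝ, ∀ᶠ t in atTop, ∃ r, r₀ ≤ r ∧ hdist (β t : Euc N) (radial r ξ) ≤ K ∧
      ∀ q ∉ W, R ≤ hdist (radial r ξ : Euc N) q := fun R => by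
    obtain ⟨T, hT⟩ := h R
    set T' := max T (hdist (origin N : Euc N) (radial r₀ ξ)) with hT'
    filter_upwards [eventually_ge_atTop 0,
      eventually_gt_atTop (T' + K + hdist (origin N : Euc N) (β 0))] with t ht0 ht
    obtain ⟨r, hr⟩ := hK t ht0
    have h1 := hβ.sub_le_hdist ht0
    have h2 := hdist_triangle (origin N) (radial r ξ) (β t)
    rw [hdist_comm (radial r ξ : Euc N)] at h2
    have h3 : T' < hdist (origin N : Euc N) (radial r ξ) := by linarith
    refine ⟨r, ?_, hr, hT r ((le_max_left _ _).trans_lt h3)⟩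
    by_contra hlt
    refine absurd ((le_max_right _ _).trans_lt h3) (not_lt.2 ?_)
    rw [hdist_origin_le_iff, depth_radial _ hξ, depth_radial _ hξ]
    have h5 : (r : ℝ) ≤ r₀ := le_of_lt (not_le.1 hlt)
    have := r.2.1
    gcongr
  constructor
  · filter_upwards [key (K + 1)] with t ⟨r, hr, hrK, hrq⟩
    refine mem_of_hdist_lt (radial_mem_connectedComponentIn hr₀ hr)
      (fun q hq => hrq q (hfr q hq)) ?_
    rw [hdist_comm]; linarith
  · intro R
    filter_upwards [key (R + K)] with t ⟨r, hr, hrK, hrq⟩ y hy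
    have h1 := hrq y (hfr y hy)
    have h2 := hdist_triangle (radial r ξ) (β t) y
    rw [hdist_comm (radial r ξ : Euc N) (β t)] at h2
    linarith

theorem tendsto_depth {ι : Type*} {l : Filter ι} {z : ι → Disc N} {ζ : ClosedDisc N}
    (hζ : ‖(ζ : Euc N)‖ = 1) (hz : Tendsto (fun n => incl (z n)) l (𝓝 ζ)) :
    Tendsto (fun n => depth (z n : Euc N)) l (𝓝 0) := by
  have h0 : depth (ζ : Euc N) = 0 := by simp [depth, hζ]
  have h : Tendsto (depth : Euc N → ℝ) (𝓝 (ζ : Euc N)) (𝓝 (depth (ζ : Euc N))) :=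
    continuous_depth.tendsto _
  rw [h0] at h
  exact h.comp (tendsto_subtype_rng.1 hz)

theorem tendsto_hdist_origin {ι : Type*} {l : Filter ι} {z : ι → Disc N} {ζ : ClosedDisc N}
    (hζ : ‖(ζ : Euc N)‖ = 1) (hz : Tendsto (fun n => incl (z n)) l (𝓝 ζ)) :
    Tendsto (fun n => hdist (origin N : Euc N) (z n)) l atTop := by
  have h1 := tendsto_depth hζ hz
  have h2 : Tendsto (fun n => depth (z n : Euc N)) l (𝓝[>] 0) :=
    tendsto_nhdsWithin_iff.2 ⟨h1, Eventually.of_forall fun n => depth_pos (z n)⟩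
  refine tendsto_atTop_mono (fun n => ?_) (Real.tendsto_log_atTop.comp h2.inv_tendsto_nhdsGT_zero)
  exact (Real.log_le_iff_le_exp (inv_pos.2 (depth_pos _))).2 (le_exp_hdist_origin (z n))

/-- A sequence close to a ray towards an endpoint of `C` is eventually in `C`. -/
theorem IsEndpoint.eventually_mem {C : Set (Disc N)} {ζ : ClosedDisc N} (hC : IsEndpoint C ζ)
    {z : ℕ → Disc N} (hz : Tendsto (fun n => incl (z n)) atTop (𝓝 ζ)) {β : ℝ → Disc N}
    (hβ : IsRayTowards β ζ) {K : ℝ}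
    (hK : ∀ n, ∃ t : ℝ, 0 ≤ t ∧ hdist (z n : Euc N) (β t : Euc N) ≤ K) :
    ∀ᶠ n in atTop, z n ∈ C := by
  choose t ht0 ht using hK
  have htt : Tendsto t atTop atTop := by
    refine tendsto_atTop_mono (fun n => ?_) (tendsto_atTop_add_const_right _
      (-(hdist (origin N : Euc N) (β 0) + K)) (tendsto_hdist_origin hC.1 hz))
    have h1 := hβ.1 0 (t n) le_rfl (ht0 n)
    rw [zero_sub, abs_neg, abs_of_nonneg (ht0 n)] at h1
    have h2 := hdist_triangle (origin N) (β 0) (β (t n))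
    have h3 := hdist_triangle (origin N) (β (t n)) (z n)
    rw [hdist_comm (β (t n) : Euc N) (z n)] at h3
    have := ht n
    linarith
  obtain ⟨h1, h2⟩ := hC.2 β hβ
  filter_upwards [htt.eventually h1, htt.eventually (h2 (K + 1))] with n hn1 hn2
  refine mem_of_hdist_lt hn1 hn2 ?_
  rw [hdist_comm]
  linarith [ht n]

/-! ### Limit sets -/

theorem norm_smul_eq_one (g : Mob N) {ζ : ClosedDisc N} (hζ : ‖(ζ : Euc N)‖ = 1) :
    ‖((g • ζ : ClosedDisc N) : Euc N)‖ = 1 := by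
  have h := g.2.1 ζ
  have h1 := mem_closedBall_zero_iff.1 (g • ζ).2
  have h2 : ¬ ‖((g • ζ : ClosedDisc N) : Euc N)‖ < 1 := fun h' => hζ.not_lt (h.1 h')
  exact le_antisymm h1 (not_lt.1 h2)

theorem tendsto_incl_of_norm_sub_sq_le {ι : Type*} {l : Filter ι} {x y : ι → Disc N}
    {ξ : ClosedDisc N} (hx : Tendsto (fun i => incl (x i)) l (𝓝 ξ)) {f : ι → ℝ}
    (hf : Tendsto f l (𝓝 0)) (h : ∀ i, ‖(x i : Euc N) - y i‖ ^ 2 ≤ f i) :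
    Tendsto (fun i => incl (y i)) l (𝓝 ξ) := by
  have h1 : Tendsto (fun i => ‖(x i : Euc N) - y i‖ ^ 2) l (𝓝 0) :=
    squeeze_zero (fun _ => sq_nonneg _) h hf
  have h2 : Tendsto (fun i => ‖(x i : Euc N) - y i‖) l (𝓝 0) := by
    have := h1.sqrt
    simpa [Real.sqrt_sq] using this
  have h3 := tendsto_zero_iff_norm_tendsto_zero.2 h2
  rw [tendsto_subtype_rng] at hx ⊢
  have := hx.sub h3
  simpa [incl] using this

theorem tendsto_smul_of_tendsto_smul {ι : Type*} {l : Filter ι} {e : ι → Mob N} {x : Disc N}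
    {ξ : ClosedDisc N} (hξ : ‖(ξ : Euc N)‖ = 1)
    (h : Tendsto (fun i => incl (e i • x)) l (𝓝 ξ)) (y : Disc N) :
    Tendsto (fun i => incl (e i • y)) l (𝓝 ξ) := by
  have h1 := tendsto_depth hξ h
  refine tendsto_incl_of_norm_sub_sq_le h
    (f := fun i => Real.exp (hdist (x : Euc N) y) * depth ((e i • x : Disc N) : Euc N))
    (by simpa using h1.const_mul (Real.exp (hdist (x : Euc N) y))) fun i => ?_
  have := norm_sub_sq_le_mul_depth (e i • x) (e i • y)
  rwa [hdist_smul_smul] at this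

/-- Changing the base point does not change the limit, and orbit points in the open ball never equal
`ξ`, so convergence already gives accumulation. -/
theorem mem_limitSet_of_tendsto {ι : Type*} {l : Filter ι} [l.NeBot] {H : Subgroup (Mob N)}
    {e : ι → Mob N} (he : ∀ i, e i ∈ H) {x : Disc N} {ξ : ClosedDisc N}
    (hξ : ‖(ξ : Euc N)‖ = 1) (h : Tendsto (fun i => incl (e i • x)) l (𝓝 ξ)) :
    ξ ∈ limitSet H := by
  have h1 := tendsto_smul_of_tendsto_smul hξ h (origin N)
  refine accPt_iff_frequently.2 (h1.frequently (Eventually.of_forall fun i => ⟨?_, e i, he i, rfl⟩).frequently)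
  intro h2
  have := mem_ball_zero_iff.1 (e i • origin N).2
  have h3 : ((e i • origin N : Disc N) : Euc N) = ξ := congrArg Subtype.val h2
  rw [h3] at this
  exact this.ne hξ

/-- Conjugation by `k` carries the end group of `C` into that of `k • C`. -/
theorem smul_mem_limitSet_endGroup {C : Set (Disc N)} {ζ : ClosedDisc N}
    (hζ : ‖(ζ : Euc N)‖ = 1) (h : ζ ∈ limitSet (endGroup G C)) {k : Mob N} (hk : k ∈ G) :
    k • ζ ∈ limitSet (endGroup G (k • C)) := by
  obtain ⟨y, hy, hlim⟩ := mem_closure_iff_seq_limit.1 (derivedSet_subset_closure _ h)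
  choose g hg hgy using hy
  have hc : ∀ i, k * g i * k⁻¹ ∈ endGroup G (k • C) := fun i => by
    have := MulAction.mem_stabilizer_iff.1 (Subgroup.mem_inf.1 (hg i)).2
    refine Subgroup.mem_inf.2
      ⟨mul_mem (mul_mem hk (Subgroup.mem_inf.1 (hg i)).1) (inv_mem hk), ?_⟩
    rw [MulAction.mem_stabilizer_iff, smul_smul, inv_mul_cancel_right, mul_smul, this]
  refine mem_limitSet_of_tendsto hc (x := k • origin N) (norm_smul_eq_one k hζ)
    (l := (atTop : Filter ℕ)) ?_
  have : Tendsto (fun i => k • y i) atTop (𝓝 (k • ζ)) := hlim.const_smul k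
  refine this.congr fun i => ?_
  rw [hgy, smul_smul (k * g i * k⁻¹), inv_mul_cancel_right, mul_smul, incl_smul, incl_smul]

/-- Images of points of a Dirichlet domain can only converge to points of the limit set, or to
images of limits of points of the domain under single elements. -/
theorem exists_open_forall_smul_notMem (hs : 0 ≤ s)
    (hfin : ∑' g : G, orbitWeight s (g : Mob N) ≠ ∞) {a : Disc N} {z : ℕ → Disc N}
    (hza : ∀ n, ∀ g ∈ G, hdist (z n : Euc N) a ≤ hdist (z n : Euc N) (g • a : Disc N))
    {ζ ξ : ClosedDisc N} (hζ : ‖(ζ : Euc N)‖ = 1) (hξ : ‖(ξ : Euc N)‖ = 1)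
    (hz : Tendsto (fun n => incl (z n)) atTop (𝓝 ζ)) {C C' : Set (Disc N)}
    (hzC : ∀ᶠ n in atTop, z n ∈ C) (hζC : ζ ∈ limitSet (endGroup G C))
    (hCC' : ∀ g ∈ G, ∀ y ∈ C, g • y ∈ C' → g • C = C') (hξC : ξ ∉ limitSet (endGroup G C')) :
    ∃ O : Set (ClosedDisc N), IsOpen O ∧ ξ ∈ O ∧
      ∀ᶠ n in atTop, ∀ g ∈ G, incl (g • z n) ∈ O → g • z n ∉ C' := by
  by_contra! hcon
  have hex : ∀ k : ℕ, ∃ n ≥ k, ∃ g ∈ G,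
      incl (g • z n) ∈ Metric.ball ξ (1 / ((k : ℝ) + 1)) ∧ g • z n ∈ C' ∧ z n ∈ C := fun k => by
    have h1 := hcon (Metric.ball ξ (1 / ((k : ℝ) + 1))) Metric.isOpen_ball
      (Metric.mem_ball_self (by positivity))
    obtain ⟨n, ⟨g, hg, h2, h3⟩, h4, h5⟩ :=
      (h1.and_eventually (hzC.and (eventually_ge_atTop k))).exists
    exact ⟨n, h5, g, hg, h2, h3, h4⟩
  choose n hn g hg hgO hgC hnC using hex
  have hgC' : ∀ k, g k • C = C' := fun k => hCC' _ (hg k) _ (hnC k) (hgC k)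
  have hlim : Tendsto (fun k => incl (g k • z (n k))) atTop (𝓝 ξ) := by
    rw [tendsto_iff_dist_tendsto_zero]
    exact squeeze_zero (fun _ => dist_nonneg) (fun k => (Metric.mem_ball.1 (hgO k)).le)
      tendsto_one_div_add_atTop_nhds_zero_nat
  have hzn : Tendsto (fun k => incl (z (n k))) atTop (𝓝 ζ) :=
    hz.comp (tendsto_atTop_mono hn tendsto_id)
  let U : Ultrafilter ℕ := Ultrafilter.of atTop
  have hU : (U : Filter ℕ) ≤ atTop := Ultrafilter.of_le _
  let e : ℕ → G := fun k => ⟨g k, hg k⟩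
  -- Along an ultrafilter the group elements either leave every finite set or are eventually
  -- constant.
  rcases (U.map e).le_cofinite_or_eq_pure with hcof | ⟨k₀, hk₀⟩
  · have he : Tendsto e U cofinite := hcof
    have hd : Tendsto (fun k => depth ((g k • origin N : Disc N) : Euc N)) U (𝓝 0) := by
      refine tendsto_order.2 ⟨fun b hb => Eventually.of_forall fun k => hb.trans (depth_pos _),
        fun b hb => ?_⟩
      filter_upwards [he.eventually (finite_orbit_lt hfin hs hb).eventually_cofinite_notMem]
        with k hk
      exact not_le.1 hk
    have hda := depth_pos a
    -- The Dirichlet condition makes `g(z)` at least as close to `g(a)` as to `a`. In Euclidean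
    -- terms `|g(z) - g(a)|²` is at most a multiple of the depth of `g(a)`, which tends to zero.
    have hlim' : Tendsto (fun k => incl (g k • a)) U (𝓝 ξ) := by
      refine tendsto_incl_of_norm_sub_sq_le (hlim.mono_left hU)
        (f := fun k => 4 * (4 * Real.exp (hdist (origin N : Euc N) a) *
          depth ((g k • origin N : Disc N) : Euc N)) / depth (a : Euc N)) ?_ fun k => ?_
      · simpa using ((hd.const_mul (4 * Real.exp (hdist (origin N : Euc N) a))).const_mul
          4).div_const (depth (a : Euc N))
      · have h1 : hdist ((g k • z (n k) : Disc N) : Euc N) (g k • a : Disc N) ≤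
            hdist ((g k • z (n k) : Disc N) : Euc N) a := by
          rw [hdist_smul_smul, hdist_smul_left]
          exact hza _ _ (inv_mem (hg k))
        rw [hdist_le_hdist_iff] at h1
        have h2 := depth_le_mul_depth (g k • origin N) (g k • a)
        rw [hdist_smul_smul] at h2
        have h3 := sinhSq_mul (g k • z (n k)) (g k • a)
        have h4 := sinhSq_mul (g k • z (n k)) a
        have h5 := depth_pos (g k • z (n k))
        have h6 := depth_pos (g k • a)
        have h7 : ‖((g k • z (n k) : Disc N) : Euc N) - a‖ ^ 2 ≤ 4 := by
          have := norm_sub_le ((g k • z (n k) : Disc N) : Euc N) a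
          have := mem_ball_zero_iff.1 (g k • z (n k)).2
          have := mem_ball_zero_iff.1 a.2
          have := norm_nonneg (((g k • z (n k) : Disc N) : Euc N) - a)
          nlinarith
        rw [le_div_iff₀ hda, ← h3]
        calc _ ≤ sinhSq ((g k • z (n k) : Disc N) : Euc N) a *
              (depth ((g k • z (n k) : Disc N) : Euc N) * depth ((g k • a : Disc N) : Euc N)) *
                depth (a : Euc N) := by gcongr
          _ = ‖((g k • z (n k) : Disc N) : Euc N) - a‖ ^ 2 * depth ((g k • a : Disc N) : Euc N) := by
              rw [← h4]; ring
          _ ≤ _ := by gcongr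
    -- All `g k` carry `C` to `C'`, so `g k * (g 0)⁻¹` stabilises `C'`.
    refine hξC (mem_limitSet_of_tendsto (l := (U : Filter ℕ)) (e := fun k => g k * (g 0)⁻¹)
      (x := g 0 • a) (fun k => ?_) hξ ?_)
    · refine Subgroup.mem_inf.2 ⟨mul_mem (hg k) (inv_mem (hg 0)), ?_⟩
      rw [MulAction.mem_stabilizer_iff, mul_smul, inv_smul_eq_iff.2 (hgC' 0).symm, hgC']
    · simpa only [mul_smul, inv_smul_smul] using hlim'
  · have hk : ∀ᶠ k in (U : Filter ℕ), e k = k₀ := by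
      have : {k₀} ∈ U.map e := by rw [hk₀]; exact Set.mem_singleton k₀
      exact this
    have h1 : Tendsto (fun k => incl (g k • z (n k))) U (𝓝 ((k₀ : Mob N) • ζ)) := by
      refine ((hzn.mono_left hU).const_smul (k₀ : Mob N)).congr' (hk.mono fun k hk => ?_)
      have : (k₀ : Mob N) = g k := (congrArg Subtype.val hk).symm
      rw [this]; rfl
    obtain ⟨k, hk⟩ := hk.exists
    -- In the constant case `ξ` is the image of `ζ`, a limit point of the end group of `C`.
    have hkC : (k₀ : Mob N) • C = C' := by rw [← hk]; exact hgC' k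
    refine hξC ?_
    rw [tendsto_nhds_unique (hlim.mono_left hU) h1, ← hkC]
    exact smul_mem_limitSet_endGroup hζ hζC k₀.2

/-! ### Null sets of ending measures -/

theorem orbitMeasure_eq_zero (z : Disc N) {V : Set (ClosedDisc N)} (hV : MeasurableSet V)
    (h : ∀ g ∈ G, g • incl z ∉ V) : orbitMeasure G s z V = 0 := by
  rw [orbitMeasure_apply z hV]
  have : ∀ g : G, V.indicator (1 : ClosedDisc N → ℝ≥0∞) ((g : Mob N) • incl z) = 0 := fun g =>
    Set.indicator_of_notMem (h g g.2) _
  simp [this]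

/-- The Dirichlet inequality makes the whole orbit of `z` recede from the origin uniformly in `g`.
-/
theorem sub_le_hdist_origin_smul {a z : Disc N} (g : Mob N)
    (h : hdist (z : Euc N) a ≤ hdist (z : Euc N) (g⁻¹ • a : Disc N)) :
    hdist (origin N : Euc N) z - 2 * hdist (origin N : Euc N) a ≤
      hdist (origin N : Euc N) (g • z : Disc N) := by
  rw [← hdist_smul_left] at h
  have h1 := hdist_triangle (g • z) (origin N) a
  have h2 := hdist_triangle (origin N) a z
  rw [hdist_comm (a : Euc N)] at h2
  rw [hdist_comm ((g • z : Disc N) : Euc N) (origin N)] at h1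
  linarith

/-- An ending measure is carried by the sphere at infinity. -/
theorem IsConformalEndingMeasure.ae_norm_eq_one {z : ℕ → Disc N} {μ : Measure (ClosedDisc N)}
    (hμ : IsConformalEndingMeasure G s z μ) {a : Disc N}
    (hza : ∀ n, ∀ g ∈ G, hdist (z n : Euc N) a ≤ hdist (z n : Euc N) (g • a : Disc N))
    (hz : Tendsto (fun n => hdist (origin N : Euc N) (z n)) atTop atTop) :
    ∀ᵐ x : ClosedDisc N ∂μ, ‖(x : Euc N)‖ = 1 := by
  have hd : Continuous fun x : ClosedDisc N => depth (x : Euc N) :=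
    Continuous.comp' continuous_depth continuous_subtype_val
  have hnull : ∀ m : ℕ, μ {x : ClosedDisc N | 1 / ((m : ℝ) + 1) < depth (x : Euc N)} = 0 := by
    intro m
    have hopen : IsOpen {x : ClosedDisc N | 1 / ((m : ℝ) + 1) < depth (x : Euc N)} :=
      isOpen_lt continuous_const hd
    refine le_antisymm (hμ.measure_le_of_isOpen hopen ?_) zero_le
    have hm : 0 < 1 / ((m : ℝ) + 1) := by positivity
    filter_upwards [hz.eventually_gt_atTop (2 * hdist (origin N : Euc N) a -
      Real.log (1 / ((m : ℝ) + 1) / 4))] with n hn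
    refine (orbitMeasure_eq_zero _ hopen.measurableSet fun g hg h => ?_).le
    have h1 : 1 / ((m : ℝ) + 1) < depth ((g • z n : Disc N) : Euc N) := h
    have h2 := depth_le_exp_neg (g • z n)
    have h3 : Real.log (1 / ((m : ℝ) + 1) / 4) < -hdist (origin N : Euc N) (g • z n : Disc N) := by
      rw [Real.log_lt_iff_lt_exp (by positivity)]
      linarith
    have h4 := sub_le_hdist_origin_smul g (hza n _ (inv_mem hg))
    linarith
  have hsub : {x : ClosedDisc N | ¬ ‖(x : Euc N)‖ = 1} ⊆
      ⋃ m : ℕ, {x : ClosedDisc N | 1 / ((m : ℝ) + 1) < depth (x : Euc N)} := fun x hx => by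
    have h2 : ‖(x : Euc N)‖ < 1 := lt_of_le_of_ne (mem_closedBall_zero_iff.1 x.2) hx
    have h3 : 0 < depth (x : Euc N) := depth_pos ⟨x.1, mem_ball_zero_iff.2 h2⟩
    obtain ⟨m, hm⟩ := exists_nat_one_div_lt h3
    exact Set.mem_iUnion.2 ⟨m, hm⟩
  exact measure_mono_null hsub (measure_iUnion_null hnull)

/-- A set is null if its neighbourhoods contain only points of the orbits that lie in shadows of
far away points of the orbit of the origin. -/
theorem IsConformalEndingMeasure.measure_eq_zero_of_shadow {z : ℕ → Disc N}
    {μ : Measure (ClosedDisc N)} (hμ : IsConformalEndingMeasure G s z μ) {B : Set (ClosedDisc N)}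
    {c C : ℝ} (h : ∀ T : ℝ, ∃ V : Set (ClosedDisc N), IsOpen V ∧ B ⊆ V ∧ ∀ᶠ n in atTop, ∀ k ∈ G,
      k • incl (z n) ∈ V → ∃ g ∈ G, T - c ≤ hdist (origin N : Euc N) (g • origin N : Disc N) ∧
        hdist (origin N : Euc N) (g • origin N : Disc N) +
          hdist ((g • origin N : Disc N) : Euc N) (k • z n : Disc N) ≤
            hdist (origin N : Euc N) (k • z n : Disc N) + C) : μ B = 0 := by
  obtain ⟨x, hx⟩ := hμ.converges
  have hfin := tsum_orbitWeight_ne_top hμ.exponent_pos hx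
  set A := ENNReal.ofReal ((4 * Real.exp C) ^ s) with hA
  have hA0 : A ≠ 0 := by
    have : 0 < (4 * Real.exp C) ^ s := by positivity
    simpa [hA] using this
  refine le_antisymm (le_of_forall_pos_le_add fun ε hε => ?_) zero_le
  rw [zero_add]
  obtain ⟨T, hT⟩ := exists_orbitTail_le hfin (ε := ε / A)
    (ENNReal.div_pos hε.ne' ENNReal.ofReal_ne_top)
  obtain ⟨V, hVo, hBV, hV⟩ := h (T + c)
  refine (measure_mono hBV).trans (hμ.measure_le_of_isOpen hVo (hV.mono fun n hn => ?_))
  refine (orbitMeasure_le_orbitTail hμ.exponent_pos.le (z n) hVo.measurableSet hn).trans ?_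
  calc A * orbitTail G s (T + c - c) ≤ A * (ε / A) := by gcongr; exact hT _ (by linarith)
    _ ≤ ε := ENNReal.mul_div_le

/-- Almost every radial ray moves away from the complement of the lift of the end. -/
theorem IsConformalEndingMeasure.ae_hdist_radial {E : Set (Orbifold G)} (hE : IsEnd G E)
    {z : ℕ → Disc N} {μ : Measure (ClosedDisc N)} (hμ : IsConformalEndingMeasure G s z μ)
    (hz : ∀ᶠ n in atTop, z n ∈ proj G ⁻¹' E) :
    ∀ᵐ ξ : ClosedDisc N ∂μ, ∀ R : ℝ, ∃ T : ℝ, ∀ r, T < hdist (origin N : Euc N) (radial r ξ) →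
      ∀ q ∉ proj G ⁻¹' E, R ≤ hdist (radial r ξ : Euc N) q := by
  obtain ⟨ρ, hρ⟩ := hE.exists_hdist_le
  have key : ∀ R : ℕ, ∀ᵐ ξ : ClosedDisc N ∂μ, ∃ T : ℝ, ∀ r, T < hdist (origin N : Euc N) (radial r ξ) →
      ∀ q ∉ proj G ⁻¹' E, R ≤ hdist (radial r ξ : Euc N) q := fun R => by
    rw [ae_iff]
    refine hμ.measure_eq_zero_of_shadow (c := R + ρ) (C := Real.log 32 + 2 * (R + ρ)) fun T => ?_
    -- For fixed `r` and `q` the conditions are open in `x`, also inside the ball; thus `V` captures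
    -- both bad boundary points and nearby orbit points.
    refine ⟨⋃ r : Set.Ico (0 : ℝ) 1, ⋃ q ∈ (proj G ⁻¹' E)ᶜ,
      {x | T < hdist (origin N : Euc N) (radial r x)} ∩ {x | hdist (radial r x : Euc N) q < R},
      ?_, ?_, ?_⟩
    · refine isOpen_iUnion fun r => isOpen_biUnion fun q _ => IsOpen.inter ?_ ?_
      · simp_rw [hdist_comm (origin N : Euc N)]
        have h' := Continuous.comp' (continuous_hdist_left (origin N)) (continuous_radial r)
        exact isOpen_lt continuous_const h'
      · have h' := Continuous.comp' (continuous_hdist_left q) (continuous_radial r)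
        exact isOpen_lt h' continuous_const
    · intro ξ hξ
      simp only [Set.mem_ofPred_eq, not_exists] at hξ
      have := hξ T
      push Not at this
      obtain ⟨r, h1, q, hq, h2⟩ := this
      exact Set.mem_iUnion.2 ⟨r, Set.mem_biUnion (x := q) hq ⟨h1, h2⟩⟩
    · filter_upwards [hz] with n hn k hk hkV
      obtain ⟨r, hr⟩ := Set.mem_iUnion.1 hkV
      obtain ⟨q, hq, h1, h2⟩ := Set.mem_iUnion₂.1 hr
      exact exists_hdist_add_le hρ (x := k • z n) (le_of_lt h1) h2
        fun h => hq (h.2 (smul_mem_preimage_proj hk hn))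
  filter_upwards [ae_all_iff.2 key] with ξ hξ R
  obtain ⟨n, hn⟩ := exists_nat_ge R
  obtain ⟨T, hT⟩ := hξ n
  exact ⟨T, fun r hr q hq => hn.trans (hT r hr q hq)⟩

/-- Almost every point to which a radial ray in the lift of the end converges is a limit point of
the corresponding end group. -/
theorem IsConformalEndingMeasure.ae_mem_limitSet {E : Set (Orbifold G)} (hE : IsEnd G E)
    {z : ℕ → Disc N} {μ : Measure (ClosedDisc N)} (hμ : IsConformalEndingMeasure G s z μ)
    {a : Disc N}
    (hza : ∀ n, ∀ g ∈ G, hdist (z n : Euc N) a ≤ hdist (z n : Euc N) (g • a : Disc N))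
    {ζ : ClosedDisc N} (hζ : ‖(ζ : Euc N)‖ = 1)
    (hz : Tendsto (fun n => incl (z n)) atTop (𝓝 ζ)) {x₀ : Disc N}
    (hzC : ∀ᶠ n in atTop, z n ∈ connectedComponentIn (proj G ⁻¹' E) x₀)
    (hζC : ζ ∈ limitSet (endGroup G (connectedComponentIn (proj G ⁻¹' E) x₀)))
    (r₀ : Set.Ico (0 : ℝ) 1) :
    ∀ᵐ ξ : ClosedDisc N ∂μ, ‖(ξ : Euc N)‖ = 1 → (∀ r, r₀ ≤ r → radial r ξ ∈ proj G ⁻¹' E) →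
      ξ ∈ limitSet (endGroup G (connectedComponentIn (proj G ⁻¹' E) (radial r₀ ξ))) := by
  have hW : IsOpen (proj G ⁻¹' E) := hE.isOpen.preimage continuous_proj
  obtain ⟨ρ, hρ⟩ := hE.exists_hdist_le
  obtain ⟨x, hx⟩ := hμ.converges
  have hfin := tsum_orbitWeight_ne_top hμ.exponent_pos hx
  rw [ae_iff]
  -- Localising lets `C'` be fixed although the component depends on the boundary point.
  refine measure_null_of_locally_null _ fun ξ hξ => ?_
  simp only [Set.mem_ofPred_eq, Classical.not_imp] at hξ
  obtain ⟨hξ1, hξW, hξL⟩ := hξ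
  set C' := connectedComponentIn (proj G ⁻¹' E) (radial r₀ ξ) with hC'
  have hC'o : IsOpen C' := hW.connectedComponentIn
  obtain ⟨O, hO, hξO, hOz⟩ := exists_open_forall_smul_notMem hμ.exponent_pos.le hfin hza hζ hξ1 hz
    hzC hζC (fun g hg y hy hy' => smul_connectedComponentIn hg hy hy') hξL
  set B := O ∩ {x | radial r₀ x ∈ C'} ∩ {x : ClosedDisc N | ‖(x : Euc N)‖ = 1 ∧
    ∀ r, r₀ ≤ r → radial r x ∈ proj G ⁻¹' E} with hB
  refine ⟨B, ?_, ?_⟩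
  · rw [hB, Set.inter_comm]
    have hO' : O ∩ {x | radial r₀ x ∈ C'} ∈ 𝓝 ξ :=
      (hO.inter (hC'o.preimage (continuous_radial r₀))).mem_nhds
        ⟨hξO, mem_connectedComponentIn (hξW r₀ le_rfl)⟩
    refine mem_of_superset (inter_mem_nhdsWithin _ hO') ?_
    · rintro y ⟨hy, hy'⟩
      simp only [Set.mem_ofPred_eq, Classical.not_imp] at hy
      exact ⟨⟨hy.1, hy.2.1⟩, hy'⟩
  · refine hμ.measure_eq_zero_of_shadow (c := 1 + ρ) (C := Real.log 32 + 2 * (1 + ρ)) fun T => ?_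
    obtain ⟨r₁, hr₁⟩ := exists_lt_hdist_radial (N := N) T
    -- Beyond `r₀` the ray stays in `C'`; beyond `r₁` it is farther than `T` from the origin.
    set r := max r₀ r₁ with hr
    refine ⟨O ∩ {x | radial r x ∈ C'} ∩ {x | T < hdist (origin N : Euc N) (radial r x)},
      ?_, ?_, ?_⟩
    · refine (hO.inter (hC'o.preimage (continuous_radial r))).inter ?_
      simp_rw [hdist_comm (origin N : Euc N)]
      have h' := Continuous.comp' (continuous_hdist_left (origin N)) (continuous_radial r)
      exact isOpen_lt continuous_const h'
    · rintro y ⟨⟨hyO, hyC⟩, hy1, hyW⟩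
      refine ⟨⟨hyO, ?_⟩, hr₁ r (le_max_right _ _) y hy1⟩
      have := radial_mem_connectedComponentIn hyW (le_max_left r₀ r₁)
      have hyC' : radial r₀ y ∈ C' := hyC
      rw [← connectedComponentIn_eq hyC'] at this
      exact this
    · filter_upwards [hOz] with n hn k hk ⟨⟨hkO, hkC⟩, hkT⟩
      refine exists_hdist_add_le (V := C') (fun y hy => hρ y
        (frontier_connectedComponentIn_subset hW _ hy)) (x := k • z n) (le_of_lt hkT)
        (q := radial r (incl (k • z n))) (by rw [hdist_self]; exact one_pos) fun h => ?_
      exact hn k hk hkO (h.1 hkC)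

/-- An ending measure obtained from an ending sequence tending to an end limit point of `E` gives
full measure to the end limit set of `E`. -/
theorem IsConformalEndingMeasure.ae_mem_endLimitSet {E : Set (Orbifold G)} (hE : IsEnd G E)
    {ζ : ClosedDisc N} (hζ : ζ ∈ endLimitSet G E) {z : ℕ → Disc N} (hz : IsEndingSequence G z ζ)
    {μ : Measure (ClosedDisc N)} (hμ : IsConformalEndingMeasure G s z μ) :
    ∀ᵐ ξ : ClosedDisc N ∂μ, ξ ∈ endLimitSet G E := by
  obtain ⟨C, ⟨x₀, hx₀, rfl⟩, hend, hlim⟩ := hζ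
  obtain ⟨F, ⟨a, -, rfl⟩, hzF, hzζ, β, hβ, -, K, hK⟩ := hz
  have hW : IsOpen (proj G ⁻¹' E) := hE.isOpen.preimage continuous_proj
  have hzC := hend.eventually_mem hzζ hβ hK
  -- Countably many starting radii tending to `1`, so that the exceptional null sets can be united.
  let ρ : ℕ → Set.Ico (0 : ℝ) 1 := fun m => ⟨1 - 1 / ((m : ℝ) + 1), by
    have h1 : 1 / ((m : ℝ) + 1) ≤ 1 := by rw [div_le_one (by positivity)]; linarith [m.cast_nonneg (α := ℝ)]
    have h2 : 0 < 1 / ((m : ℝ) + 1) := by positivity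
    exact ⟨by linarith, by linarith⟩⟩
  filter_upwards [hμ.ae_norm_eq_one hzF (tendsto_hdist_origin hend.1 hzζ),
    hμ.ae_hdist_radial hE (hzC.mono fun n hn => connectedComponentIn_subset _ _ hn),
    ae_all_iff.2 fun m => hμ.ae_mem_limitSet hE hzF hend.1 hzζ hzC hlim (ρ m)] with ξ h1 h2 h3
  -- Any positive value works: a ray point outside `W` would be at distance `0` from the complement.
  obtain ⟨T, hT⟩ := h2 1
  obtain ⟨r₁, hr₁⟩ := exists_lt_hdist_radial (N := N) T
  obtain ⟨m, hm⟩ := exists_nat_one_div_lt (sub_pos.2 r₁.2.2)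
  have hr : ∀ r, ρ m ≤ r → radial r ξ ∈ proj G ⁻¹' E := fun r hr => by
    by_contra h
    have hle : r₁ ≤ ρ m := Subtype.coe_le_coe.1 (by
      change (r₁ : ℝ) ≤ 1 - 1 / ((m : ℝ) + 1)
      linarith)
    have := hT r (hr₁ r (hle.trans hr) ξ h1) _ h
    rw [hdist_self] at this
    linarith
  exact ⟨_, ⟨_, hr _ le_rfl, rfl⟩, isEndpoint_of_radial hW h1 h2 hr, h3 m h1 hr⟩

end ConformalEnding

end

open ConformalEnding in
theorem mainTheorem11 (N : ℕ) (hN : 1 ≤ N) (G : Subgroup (Mob N)) (hG : IsKleinian G)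
    (E : Set (Orbifold G)) (hE : IsEnd G E) (hcount : (endLimitSet G E).Countable)
    (ζ : ClosedDisc N) (hζ : ζ ∈ endLimitSet G E)
    (z : ℕ → Disc N) (hz : IsEndingSequence G z ζ)
    (s : ℝ) (μ : Measure (ClosedDisc N)) (hμ : IsConformalEndingMeasure G s z μ) :
    IsPurelyAtomic μ := by
  exact ⟨_, hcount, ae_iff.1 (hμ.ae_mem_endLimitSet hE hζ hz)⟩
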